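/- Let $d,m\ge 1$ be integers, $1\le p<d/m$, $p^*=\frac{dp}{d-mp}$, $0<q\le r\le\infty$, with $q\le 1$ if $p=1$, and let $\Omega\subseteq\mathbb R^d$ be a non-empty open set (not necessarily bounded). For a measurable $f:\Omega\to\mathbb R$ put $$\|f\|_{L^{s,r}(\Omega)}=s^{1/r}\Big(\int_0^\infty t^{r-1}\,|\{x\in\Omega:|f(x)|>t\}|^{r/s}\,dt\Big)^{1/r}\quad(r<\infty),\qquad \|f\|_{L^{s,\infty}(\Omega)}=\sup_{t>0}t\,|\{x\in\Omega:|f(x)|>t\}|^{1/s},$$ with values in $[0,\infty]$, where $0<s<\infty$. Let $W^mL^{p,q}(\Omega)$ be the space of all $f\in L^1(\Omega)$ whose distributional derivatives of order at most $m$ lie in $L^{p,q}(\Omega)$, with quasi-norm $\|f\|_{W^mL^{p,q}(\Omega)}=\sum_{|\alpha|\le m}\|\partial^\alpha f\|_{L^{p,q}(\Omega)}$, and let $W^m_0L^{p,q}(\Omega)$ be the closure of $C_c^\infty(\Omega)$ in it. For $n\ge1$ the $n$-th Bernstein number of the embedding $W_0^mL^{p,q}(\Omega)\hookrightarrow L^{p^*,r}(\Omega)$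 is $$b_n=\sup_{X_n}\ \inf\big\{\|f\|_{L^{p^*,r}(\Omega)}: f\in X_n,\ \|f\|_{W^mL^{p,q}(\Omega)}=1\big\}\in[0,\infty],$$ the supremum being over all $n$-dimensional linear subspaces $X_n$ of $W_0^mL^{p,q}(\Omega)$. Then: 1. There is a constant $c>0$ such that $b_n\ge c\,n^{\frac1r-\frac1q}$ for all $n\ge1$ (with $1/\infty=0$). 2. If $p<q<r<p^*$, the exponent $\min\big(\frac1{p+\varepsilon},\frac1q\big)\big(1-\max\big(\frac qr,\frac p{p^*}+\varepsilon\big)\big)$ of the upper bound $$b_n\le C_\varepsilon\, n^{-\min\left(\frac1{p+\varepsilon},\frac1q\right)\left(1-\max\left(\frac qr,\frac p{p^*}+\varepsilon\right)\right)}$$ is sharp for all sufficiently small $\varepsilon>0$: it equals $\frac1q-\frac1r$, and if $\beta,C\in\mathbb R$ satisfy $b_n\le C n^{-\beta}$ for all $n\ge1$, then $\beta$ is at most this exponent. 3. If $q=r$, the embedding $W_0^mL^{p,q}(\Omega)\hookrightarrow L^{p^*,q}(\Omega)$ is not strictly singular: there are an infinite-dimensional linear subspace $Z\subseteq W_0^mL^{p,q}(\Omega)$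 and constants $0<c\le C<\infty$ with $c\,\|f\|_{W^mL^{p,q}(\Omega)}\le\|f\|_{L^{p^*,q}(\Omega)}\le C\,\|f\|_{W^mL^{p,q}(\Omega)}$ for all $f\in Z$. -/

import Mathlib

open MeasureTheory TopologicalSpace
open scoped ENNReal NNReal Distributions

noncomputable section

/-- The Lorentz quasi-norm
`‖f‖_{L^{p,r}(μ)} = p^{1/r} (∫₀^∞ t^{r-1} μ{|f| > t}^{r/p} dt)^{1/r}` for `0 < r < ∞`, and
`‖f‖_{L^{p,∞}(μ)} = sup_{t > 0} t μ{|f| > t}^{1/p}`, with values in `[0, ∞]`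
(the value is `∞` exactly when the measurable function `f` does not belong to `L^{p,r}(μ)`). -/
def lorentzNorm {X : Type*} [MeasurableSpace X] (μ : Measure X) (p : ℝ) (r : ℝ≥0∞)
    (f : X → ℝ) : ℝ≥0∞ :=
  if r = ∞ then
    ⨆ (t : ℝ) (_ : 0 < t), ENNReal.ofReal t * μ {x | t < |f x|} ^ (1 / p)
  else
    ENNReal.ofReal (p ^ (1 / r.toReal)) *
      (∫⁻ t in Set.Ioi (0 : ℝ), ENNReal.ofReal (t ^ (r.toReal - 1)) *
        μ {x | t < |f x|} ^ (r.toReal / p)) ^ (1 / r.toReal)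

/-- Real-valued measurable functions on the open set `Ω ⊆ ℝ^d`, modulo equality almost everywhere
on `Ω` with respect to Lebesgue measure. -/
abbrev MeasFun {d : ℕ} (Ω : Opens (EuclideanSpace ℝ (Fin d))) : Type :=
  EuclideanSpace ℝ (Fin d) →ₘ[(volume : Measure (EuclideanSpace ℝ (Fin d))).restrict Ω] ℝ

/-- The Lorentz quasi-norm on `Ω` with respect to Lebesgue measure. -/
def lorentzNormOn {d : ℕ} (Ω : Opens (EuclideanSpace ℝ (Fin d))) (p : ℝ) (r : ℝ≥0∞)
    (f : MeasFun Ω) : ℝ≥0∞ :=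
  lorentzNorm ((volume : Measure (EuclideanSpace ℝ (Fin d))).restrict Ω) p r f

/-- The classical derivative `∂^α φ = ∂₁^{α₁} ⋯ ∂_d^{α_d} φ` of a test function `φ ∈ C_c^∞(Ω)`. -/
def testDeriv {d : ℕ} {Ω : Opens (EuclideanSpace ℝ (Fin d))} (α : Fin d → ℕ) (φ : 𝓓(Ω, ℝ)) :
    𝓓(Ω, ℝ) :=
  (List.finRange d).foldr
    (fun i ψ => (fun χ : 𝓓(Ω, ℝ) =>
      LineDeriv.lineDerivOp (EuclideanSpace.single i (1 : ℝ)) χ)^[α i] ψ) φ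

/-- `g` is the distributional derivative `∂^α f` of `f` on `Ω`; both are locally integrable
functions on `Ω`. -/
def IsWeakDeriv {d : ℕ} (Ω : Opens (EuclideanSpace ℝ (Fin d))) (α : Fin d → ℕ)
    (f g : MeasFun Ω) : Prop :=
  LocallyIntegrableOn f Ω volume ∧ LocallyIntegrableOn g Ω volume ∧
    ∀ φ : 𝓓(Ω, ℝ),
      ∫ x in (Ω : Set (EuclideanSpace ℝ (Fin d))), f x * testDeriv α φ x =
        (-1) ^ (∑ i, α i) * ∫ x in (Ω : Set (EuclideanSpace ℝ (Fin d))), g x * φ x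

/-- `‖∂^α f‖_{L^{p,r}(Ω)}`. The distributional derivative is unique if it exists as a function, so
the infimum is the quasi-norm of that derivative; it is `∞` if there is no such derivative. -/
def weakDerivNorm {d : ℕ} (Ω : Opens (EuclideanSpace ℝ (Fin d))) (p : ℝ) (r : ℝ≥0∞)
    (α : Fin d → ℕ) (f : MeasFun Ω) : ℝ≥0∞ :=
  ⨅ (g : MeasFun Ω) (_ : IsWeakDeriv Ω α f g), lorentzNormOn Ω p r g

/-- The Sobolev-Lorentz quasi-norm `∑_{|α| ≤ m} ‖∂^α f‖_{L^{p,r}(Ω)}`, with values in `[0, ∞]`. -/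
def sobolevNorm {d : ℕ} (Ω : Opens (EuclideanSpace ℝ (Fin d))) (m : ℕ) (p : ℝ) (r : ℝ≥0∞)
    (f : MeasFun Ω) : ℝ≥0∞ :=
  ∑ k ∈ Finset.range (m + 1), ∑ α ∈ Finset.piAntidiag (Finset.univ : Finset (Fin d)) k,
    weakDerivNorm Ω p r α f

/-- The Sobolev-Lorentz space `W^m L^{p,r}(Ω)`: the functions in `L¹(Ω)` all of whose
distributional derivatives of order at most `m` belong to `L^{p,r}(Ω)`. -/
def sobolevSpace {d : ℕ} (Ω : Opens (EuclideanSpace ℝ (Fin d))) (m : ℕ) (p : ℝ) (r : ℝ≥0∞) :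
    Set (MeasFun Ω) :=
  {f | Integrable f ((volume : Measure (EuclideanSpace ℝ (Fin d))).restrict Ω) ∧
    sobolevNorm Ω m p r f < ∞}

/-- The class modulo a.e. equality of a test function. -/
def testClass {d : ℕ} {Ω : Opens (EuclideanSpace ℝ (Fin d))} (φ : 𝓓(Ω, ℝ)) : MeasFun Ω :=
  AEEqFun.mk φ φ.contDiff.continuous.aestronglyMeasurable

/-- `W₀^m L^{p,r}(Ω)`: the closure of `C_c^∞(Ω)` in `W^m L^{p,r}(Ω)`. -/
def sobolevSpaceZero {d : ℕ} (Ω : Opens (EuclideanSpace ℝ (Fin d))) (m : ℕ) (p : ℝ)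
    (r : ℝ≥0∞) : Set (MeasFun Ω) :=
  {f ∈ sobolevSpace Ω m p r |
    ∀ ε : ℝ≥0∞, 0 < ε → ∃ φ : 𝓓(Ω, ℝ), sobolevNorm Ω m p r (f - testClass φ) < ε}

/-- The `n`-th Bernstein number of a linear map `T` on the quasi-normed space `D` (a linear
subspace of `V`, with quasi-norm `NV`), with values in the quasi-normed space
`{w | NW w < ∞} ⊆ W`:
`b_n(T) = sup { inf { ‖T x‖ : x ∈ V_n, ‖x‖ = 1 } : V_n ⊆ D an n-dimensional subspace }`. -/
def bernsteinNumber {V W : Type*} [AddCommGroup V] [Module ℝ V] [AddCommGroup W] [Module ℝ W]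
    (D : Set V) (NV : V → ℝ≥0∞) (NW : W → ℝ≥0∞) (T : V →ₗ[ℝ] W) (n : ℕ) : ℝ≥0∞ :=
  ⨆ (U : Submodule ℝ V) (_ : (U : Set V) ⊆ D) (_ : FiniteDimensional ℝ U)
    (_ : Module.finrank ℝ U = n), ⨅ (x : V) (_ : x ∈ U) (_ : NV x = 1), NW (T x)

/-- `T` is strictly singular on `D`: there is no infinite-dimensional subspace `Z ⊆ D` such that
`T` restricted to `Z` is an isomorphism of `Z` onto `T Z`. -/
def StrictlySingular {V W : Type*} [AddCommGroup V] [Module ℝ V] [AddCommGroup W] [Module ℝ W]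
    (D : Set V) (NV : V → ℝ≥0∞) (NW : W → ℝ≥0∞) (T : V →ₗ[ℝ] W) : Prop :=
  ¬ ∃ Z : Submodule ℝ V, (Z : Set V) ⊆ D ∧ ¬ FiniteDimensional ℝ Z ∧
    ∃ c C : ℝ≥0, 0 < c ∧ ∀ x ∈ Z, c * NV x ≤ NW (T x) ∧ NW (T x) ≤ C * NV x

/-- The critical Sobolev exponent `p* = dp / (d - mp)`. -/
def sobolevConj (d m : ℕ) (p : ℝ) : ℝ := d * p / (d - m * p)

/-- `b_n(W₀^m L^{p,q}(Ω) ↪ L^{p*,r}(Ω))`. -/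
def sobolevBernstein {d : ℕ} (Ω : Opens (EuclideanSpace ℝ (Fin d))) (m : ℕ) (p : ℝ)
    (q r : ℝ≥0∞) (n : ℕ) : ℝ≥0∞ :=
  bernsteinNumber (sobolevSpaceZero Ω m p q) (sobolevNorm Ω m p q)
    (lorentzNormOn Ω (sobolevConj d m p) r) LinearMap.id n

/-- The decay exponent
`min (1/(p+ε), 1/q) * (1 - max (q/r, p/p* + ε))` of the general upper bound
`b_n ≤ C_ε n^{-min (1/(p+ε), 1/q) (1 - max (q/r, p/p* + ε))}`, for finite `q` and `r`. -/
def upperExponent (d m : ℕ) (p q r ε : ℝ) : ℝ :=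
  min (1 / (p + ε)) (1 / q) * (1 - max (q / r) (p / sobolevConj d m p + ε))

end

/-! Both norms in the embedding are invariant under the same concentration: since `d / p* + m = d /
p`, the functions `L ^ (d / p*) * φ (L • (x - y))` have the same `L^{p*,r}` norm for all `L`, and so
do their derivatives of order `m` in `L^{p,q}`, while lower derivatives stay bounded when `L ≥ 1`.
Such bumps are placed on disjoint balls in `Ω` whose radii decrease geometrically
(`exists_ballFamily`).

For widely separated scales a Lorentz norm behaves like a sequence norm. Let the `j`-th bump live on
a set of measure about `w j` at height about `T j = |a j| * w j ^ (-1 / σ)`. The distribution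
function at level `t` is then about the sum of the `w j` with `t < T j`. This sum is geometric,
hence comparable to its largest term, so raising it to the power `r / σ` is the same, up to
constants, as raising each term to that power. Integrating term by term gives the `ℓ^r` norm of `a`,
whatever `σ` is (`exists_lorentzNorm_le_seqNorm`, `exists_seqNorm_le_lorentzNorm`).

On the span of the bumps the embedding is therefore the identity from `ℓ^q` to `ℓ^r` on finite
sequences (`exists_bump_sequence`). Hölder's inequality on the span of the first `n` bumps yields
the lower bound. Sharpness of the exponent follows by letting `n` tend to infinity, and for `q = r`
the whole span witnesses the failure of strict singularity. -/

noncomputable section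

/-! ### Sequence norms and geometrically decreasing weights -/

/-- The `ℓ^r` quasi-norm of the restriction of a sequence to a finite set. -/
def seqNorm (r : ℝ≥0∞) (s : Finset ℕ) (a : ℕ → ℝ) : ℝ≥0∞ :=
  if r = ∞ then s.sup fun j => ‖a j‖ₑ
  else (∑ j ∈ s, ‖a j‖ₑ ^ r.toReal) ^ (1 / r.toReal)

/-- A sequence of positive numbers that is at least halved at each step. -/
structure Halving (w : ℕ → ℝ) : Prop where
  pos : ∀ j, 0 < w j
  succ_le : ∀ j, w (j + 1) ≤ w j / 2

namespace Halving

variable {w : ℕ → ℝ} (hw : Halving w)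
include hw

lemma add_le (j k : ℕ) : w (j + k) ≤ (1 / 2) ^ k * w j := by
  induction k with
  | zero => simp
  | succ k ih =>
    have := hw.succ_le (j + k)
    rw [← add_assoc, pow_succ]
    linarith

lemma ofReal_add_rpow_le {θ : ℝ} (hθ : 0 < θ) (j k : ℕ) :
    ENNReal.ofReal (w (j + k)) ^ θ ≤ (2⁻¹ ^ θ) ^ k * ENNReal.ofReal (w j) ^ θ := by
  have h : ENNReal.ofReal (w (j + k)) ≤ 2⁻¹ ^ k * ENNReal.ofReal (w j) := by
    refine (ENNReal.ofReal_le_ofReal (hw.add_le j k)).trans ?_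
    rw [ENNReal.ofReal_mul (by positivity), ENNReal.ofReal_pow (by norm_num)]
    gcongr
    rw [one_div, ENNReal.ofReal_inv_of_pos (by norm_num)]
    simp
  calc _ ≤ (2⁻¹ ^ k * ENNReal.ofReal (w j)) ^ θ := by gcongr
    _ = _ := by
      rw [ENNReal.mul_rpow_of_nonneg _ _ hθ.le, ← ENNReal.rpow_natCast, ← ENNReal.rpow_natCast,
        ← ENNReal.rpow_mul, ← ENNReal.rpow_mul, mul_comm θ]

/-- The least index carries the largest weight, and `j ↦ j - S.min' hS` embeds `S` into the index
set of a full geometric series; gaps in `S` only help. -/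
lemma sum_rpow_le {θ : ℝ} (hθ : 0 < θ) (S : Finset ℕ) (hS : S.Nonempty) :
    ∑ j ∈ S, ENNReal.ofReal (w j) ^ θ ≤
      (1 - 2⁻¹ ^ θ)⁻¹ * ENNReal.ofReal (w (S.min' hS)) ^ θ := by
  set j₀ := S.min' hS
  have hj : ∀ j ∈ S, j₀ ≤ j := fun j hj => S.min'_le j hj
  have hinj : Set.InjOn (fun j => j - j₀) (S : Set ℕ) := by
    intro a ha b hb hab
    have := hj a ha
    have := hj b hb
    simp only at hab
    omega
  calc ∑ j ∈ S, ENNReal.ofReal (w j) ^ θ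
      ≤ ∑ j ∈ S, (2⁻¹ ^ θ) ^ (j - j₀) * ENNReal.ofReal (w j₀) ^ θ := by
        refine Finset.sum_le_sum fun j hjS => ?_
        have := hw.ofReal_add_rpow_le hθ j₀ (j - j₀)
        rwa [Nat.add_sub_cancel' (hj j hjS)] at this
    _ = (∑ k ∈ S.image (fun j => j - j₀), (2⁻¹ ^ θ) ^ k) * ENNReal.ofReal (w j₀) ^ θ := by
        rw [Finset.sum_image hinj, Finset.sum_mul]
    _ ≤ (∑' k : ℕ, (2⁻¹ ^ θ : ℝ≥0∞) ^ k) * ENNReal.ofReal (w j₀) ^ θ := by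
        gcongr
        exact ENNReal.sum_le_tsum _
    _ = _ := by rw [ENNReal.tsum_geometric]

end Halving

lemma geometric_const_ne_top {θ : ℝ} (hθ : 0 < θ) : (1 - (2⁻¹ : ℝ≥0∞) ^ θ)⁻¹ ≠ ∞ := by
  have h : (2⁻¹ : ℝ≥0∞) ^ θ < 1 := ENNReal.rpow_lt_one (by simp) hθ
  exact ENNReal.inv_ne_top.2 (tsub_pos_of_lt h).ne'

/-! ### Lorentz norms at separated scales are sequence norms -/

/-- `∫₀^T t^{ρ-1} dt = T^ρ / ρ`. -/
lemma lintegral_rpow_mul_ite_lt {ρ T : ℝ} (hρ : 0 < ρ) (hT : 0 ≤ T) (c : ℝ≥0∞) :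
    ∫⁻ t in Set.Ioi (0 : ℝ), ENNReal.ofReal (t ^ (ρ - 1)) * (if t < T then c else 0) =
      c * ENNReal.ofReal T ^ ρ * ENNReal.ofReal (1 / ρ) := by
  have h1 : ∀ t : ℝ, ENNReal.ofReal (t ^ (ρ - 1)) * (if t < T then c else 0) =
      (Set.Iio T).indicator (fun t => ENNReal.ofReal (t ^ (ρ - 1)) * c) t := by
    intro t
    by_cases h : t < T <;> simp [h]
  simp_rw [h1]
  rw [lintegral_indicator measurableSet_Iio, Measure.restrict_restrict measurableSet_Iio,
    lintegral_mul_const _ (by fun_prop), Set.inter_comm, Set.Ioi_inter_Iio,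
    setLIntegral_congr Ioo_ae_eq_Ioc]
  have hint : IntervalIntegrable (fun t : ℝ => t ^ (ρ - 1)) volume 0 T :=
    intervalIntegral.intervalIntegrable_rpow' (by linarith)
  rw [← ofReal_integral_eq_lintegral_ofReal
    ((intervalIntegrable_iff_integrableOn_Ioc_of_le hT).1 hint), ← intervalIntegral.integral_of_le hT,
    integral_rpow (Or.inl (by linarith)), ENNReal.ofReal_rpow_of_nonneg hT hρ.le, mul_comm, mul_assoc,
    ← ENNReal.ofReal_mul (by positivity)]
  · congr 2
    rw [sub_add_cancel, Real.zero_rpow hρ.ne']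
    ring
  · filter_upwards [ae_restrict_mem measurableSet_Ioc] with t ht
    exact Real.rpow_nonneg ht.1.le _

/-- The power `w ^ (-1 / σ)` normalises a bump of measure `w` in `L^{σ,r}`: height times measure to
the power `1 / σ` no longer depends on `w`. -/
lemma ofReal_threshold_mul {σ M w : ℝ} (hM : 0 ≤ M) (hw : 0 < w) (a : ℝ) :
    ENNReal.ofReal (M * |a| * w ^ (-1 / σ)) * ENNReal.ofReal w ^ (1 / σ) =
      ENNReal.ofReal M * ‖a‖ₑ := by
  rw [ENNReal.ofReal_rpow_of_pos hw, ← ENNReal.ofReal_mul (by positivity), Real.enorm_eq_ofReal_abs,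
    ← ENNReal.ofReal_mul hM, mul_assoc (M * |a|), ← Real.rpow_add hw]
  congr 1
  rw [neg_div, neg_add_cancel, Real.rpow_zero, mul_one]

/-- The integral `∫₀^∞ t^{ρ-1} ∑_{t < T_j} w_j^{ρ/σ} dt` for `T_j = M |a_j| w_j^{-1/σ}`. -/
lemma lintegral_rpow_mul_sum_threshold {σ M ρ : ℝ} (hρ : 0 < ρ) (hM : 0 ≤ M)
    {w : ℕ → ℝ} (hw : Halving w) (s : Finset ℕ) (a : ℕ → ℝ) :
    ∫⁻ t in Set.Ioi (0 : ℝ), ENNReal.ofReal (t ^ (ρ - 1)) *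
      ∑ j ∈ s with t < M * |a j| * w j ^ (-1 / σ), ENNReal.ofReal (w j) ^ (ρ / σ) =
    ENNReal.ofReal M ^ ρ * ENNReal.ofReal (1 / ρ) * ∑ j ∈ s, ‖a j‖ₑ ^ ρ := by
  simp_rw [Finset.sum_filter, Finset.mul_sum]
  rw [lintegral_finsetSum']
  · refine Finset.sum_congr rfl fun j _ => ?_
    have hwj := hw.pos j
    rw [lintegral_rpow_mul_ite_lt hρ (by positivity)]
    have h := congrArg (· ^ ρ) (ofReal_threshold_mul (σ := σ) hM hwj (a j))
    simp only [ENNReal.mul_rpow_of_nonneg _ _ hρ.le, ← ENNReal.rpow_mul] at h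
    rw [mul_comm (ENNReal.ofReal (w j) ^ (ρ / σ)), show ρ / σ = 1 / σ * ρ by ring, h]
    ring
  · intro j _
    refine AEMeasurable.mul (by fun_prop) (Measurable.aemeasurable ?_)
    exact Measurable.ite measurableSet_Iio measurable_const measurable_const

section Comparison

variable {X : Type*} [MeasurableSpace X] (μ : Measure X) {σ : ℝ} (hσ : 0 < σ) {r : ℝ≥0∞}
  (hr : 0 < r) {w : ℕ → ℝ} (hw : Halving w) {M : ℝ} (hM : 0 < M)
include hσ hr hw hM

/-- At each level the bound on the distribution function is geometric, so its power is at most a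
constant times the power of its largest term, hence at most a constant times the sum of the powers.
Only the distribution function of `F` enters. -/
theorem exists_lorentzNorm_le_seqNorm {A : ℝ≥0∞} (hA : A ≠ ∞) :
    ∃ C : ℝ≥0∞, C ≠ ∞ ∧ ∀ (s : Finset ℕ) (a : ℕ → ℝ) (F : X → ℝ),
      (∀ t : ℝ, 0 < t → μ {x | t < |F x|} ≤
        A * ∑ j ∈ s with t < M * |a j| * w j ^ (-1 / σ), ENNReal.ofReal (w j)) →
      lorentzNorm μ σ r F ≤ C * seqNorm r s a := by
  set G : ℝ≥0∞ := (1 - 2⁻¹ ^ (1 : ℝ))⁻¹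
  have hG : G ≠ ∞ := geometric_const_ne_top one_pos
  have hmin : ∀ S : Finset ℕ, ∀ hS : S.Nonempty,
      ∑ j ∈ S, ENNReal.ofReal (w j) ≤ G * ENNReal.ofReal (w (S.min' hS)) := by
    intro S hS
    simpa only [G, ENNReal.rpow_one] using hw.sum_rpow_le one_pos S hS
  by_cases hr' : r = ∞
  · refine ⟨(A * G) ^ (1 / σ) * ENNReal.ofReal M, by finiteness, fun s a F hF => ?_⟩
    simp only [lorentzNorm, seqNorm, if_pos hr']
    refine iSup₂_le fun t ht => ?_
    set S := s.filter fun j => t < M * |a j| * w j ^ (-1 / σ)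
    rcases S.eq_empty_or_nonempty with hS | hS
    · have : μ {x | t < |F x|} = 0 := by simpa [S, hS] using hF t ht
      rw [this, ENNReal.zero_rpow_of_pos (by positivity)]
      simp
    -- The smallest active index has the largest weight and controls the measure, while its
    -- threshold controls `t`.
    · set j := S.min' hS
      have hj : j ∈ s ∧ t < M * |a j| * w j ^ (-1 / σ) := by
        simpa [S] using S.min'_mem hS
      calc ENNReal.ofReal t * μ {x | t < |F x|} ^ (1 / σ)
          ≤ ENNReal.ofReal (M * |a j| * w j ^ (-1 / σ)) *
              (A * (G * ENNReal.ofReal (w j))) ^ (1 / σ) := by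
            gcongr
            · exact hj.2.le
            · exact (hF t ht).trans (by gcongr; exact hmin S hS)
        _ = (A * G) ^ (1 / σ) * (ENNReal.ofReal (M * |a j| * w j ^ (-1 / σ)) *
              ENNReal.ofReal (w j) ^ (1 / σ)) := by
            rw [← mul_assoc A, ENNReal.mul_rpow_of_nonneg _ _ (by positivity)]
            ring
        _ = (A * G) ^ (1 / σ) * ENNReal.ofReal M * ‖a j‖ₑ := by
            rw [ofReal_threshold_mul hM.le (hw.pos j), mul_assoc]
        _ ≤ _ := by
            gcongr
            exact Finset.le_sup (f := fun j => ‖a j‖ₑ) hj.1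
  · have hρ : 0 < r.toReal := ENNReal.toReal_pos hr.ne' hr'
    set ρ := r.toReal
    set K : ℝ≥0∞ := (A * G) ^ (ρ / σ) * (ENNReal.ofReal M ^ ρ * ENNReal.ofReal (1 / ρ))
    refine ⟨ENNReal.ofReal (σ ^ (1 / ρ)) * K ^ (1 / ρ), by finiteness, fun s a F hF => ?_⟩
    simp only [lorentzNorm, seqNorm, if_neg hr']
    rw [mul_assoc, ← ENNReal.mul_rpow_of_nonneg _ _ (by positivity)]
    gcongr
    rw [show K * ∑ j ∈ s, ‖a j‖ₑ ^ ρ = (A * G) ^ (ρ / σ) * (ENNReal.ofReal M ^ ρ *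
        ENNReal.ofReal (1 / ρ) * ∑ j ∈ s, ‖a j‖ₑ ^ ρ) by simp only [K]; ring,
      ← lintegral_rpow_mul_sum_threshold (σ := σ) hρ hM.le hw s a,
      ← lintegral_const_mul' _ _ (by finiteness)]
    refine setLIntegral_mono_ae' measurableSet_Ioi (.of_forall fun t ht => ?_)
    rw [mul_left_comm]
    gcongr
    set S := s.filter fun j => t < M * |a j| * w j ^ (-1 / σ)
    rcases S.eq_empty_or_nonempty with hS | hS
    · have : μ {x | t < |F x|} = 0 := by simpa [S, hS] using hF t ht
      rw [this, ENNReal.zero_rpow_of_pos (by positivity)]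
      simp
    · calc μ {x | t < |F x|} ^ (ρ / σ)
          ≤ (A * (G * ENNReal.ofReal (w (S.min' hS)))) ^ (ρ / σ) := by
            gcongr
            exact (hF t ht).trans (by gcongr; exact hmin S hS)
        _ = (A * G) ^ (ρ / σ) * ENNReal.ofReal (w (S.min' hS)) ^ (ρ / σ) := by
            rw [← mul_assoc A, ENNReal.mul_rpow_of_nonneg _ _ (by positivity)]
        _ ≤ _ := by
            gcongr
            exact Finset.single_le_sum (f := fun j => ENNReal.ofReal (w j) ^ (ρ / σ))
              (fun _ _ => zero_le) (S.min'_mem hS)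

/-- Here the geometric sum estimate is applied to the powers `w j ^ (r / σ)`: their sum over the
active indices is controlled by the term of least index, and that single bump already bounds the
distribution function from below. -/
theorem exists_seqNorm_le_lorentzNorm {κ : ℝ≥0∞} (hκ : κ ≠ 0) (hκ' : κ ≠ ∞) :
    ∃ C : ℝ≥0∞, C ≠ ∞ ∧ ∀ (s : Finset ℕ) (a : ℕ → ℝ) (F : X → ℝ),
      (∀ t : ℝ, 0 < t → ∀ j ∈ s, t < M * |a j| * w j ^ (-1 / σ) →
        κ * ENNReal.ofReal (w j) ≤ μ {x | t < |F x|}) →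
      seqNorm r s a ≤ C * lorentzNorm μ σ r F := by
  by_cases hr' : r = ∞
  · set K : ℝ≥0∞ := ENNReal.ofReal (M / 2) * κ ^ (1 / σ)
    have hK : K ≠ 0 := by
      simp only [K, ne_eq, mul_eq_zero, not_or]
      exact ⟨by simpa using hM, by simp [hκ, hκ']⟩
    have hK' : K ≠ ∞ := by finiteness
    refine ⟨K⁻¹, by finiteness, fun s a F hF => ?_⟩
    simp only [lorentzNorm, seqNorm, if_pos hr']
    refine Finset.sup_le fun j hj => ?_
    rw [mul_comm, ← div_eq_mul_inv, ENNReal.le_div_iff_mul_le (.inl hK) (.inl hK')]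
    rcases eq_or_ne (a j) 0 with h0 | h0
    · simp [h0]
    have hwj := hw.pos j
    -- Half the threshold serves as test level: the hypothesis needs a level strictly below the
    -- threshold, and the factor 2 goes into the constant.
    have hT : 0 < M / 2 * |a j| * w j ^ (-1 / σ) := by positivity
    refine le_trans ?_ (le_iSup₂_of_le _ hT le_rfl)
    calc ‖a j‖ₑ * K = κ ^ (1 / σ) * (ENNReal.ofReal (M / 2) * ‖a j‖ₑ) := by
          simp only [K]; ring
      _ = ENNReal.ofReal (M / 2 * |a j| * w j ^ (-1 / σ)) *
            (κ * ENNReal.ofReal (w j)) ^ (1 / σ) := by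
          rw [← ofReal_threshold_mul (σ := σ) (half_pos hM).le hwj,
            ENNReal.mul_rpow_of_nonneg _ _ (by positivity)]
          ring
      _ ≤ _ := by
          gcongr
          refine hF _ hT j hj ?_
          have : 0 < |a j| * w j ^ (-1 / σ) := by positivity
          nlinarith
  · have hρ : 0 < r.toReal := ENNReal.toReal_pos hr.ne' hr'
    set ρ := r.toReal
    have hθ : 0 < ρ / σ := by positivity
    set G : ℝ≥0∞ := (1 - 2⁻¹ ^ (ρ / σ))⁻¹
    have hG : G ≠ ∞ := geometric_const_ne_top hθ
    set K : ℝ≥0∞ := ENNReal.ofReal M ^ ρ * ENNReal.ofReal (1 / ρ)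
    have hK' : K ≠ ∞ := by finiteness
    have hK : K ≠ 0 := by
      simp only [K, ne_eq, mul_eq_zero, not_or]
      exact ⟨by simp [hM], by simpa using hρ⟩
    set D : ℝ≥0∞ := ENNReal.ofReal (σ ^ (1 / ρ))
    have hD : D ≠ 0 := by simp only [D, ne_eq, ENNReal.ofReal_eq_zero, not_le]; positivity
    have hD' : D ≠ ∞ := by finiteness
    set κ' : ℝ≥0∞ := (κ ^ (ρ / σ))⁻¹
    have hκθ : κ ^ (ρ / σ) ≠ 0 := by simp [hκ, hκ']
    have hκθ' : κ ^ (ρ / σ) ≠ ∞ := by finiteness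
    have hκ'' : κ' ≠ ∞ := by finiteness
    refine ⟨(K⁻¹ * (κ' * G)) ^ (1 / ρ) * D⁻¹, by finiteness, fun s a F hF => ?_⟩
    simp only [lorentzNorm, seqNorm, if_neg hr']
    rw [mul_assoc, ← mul_assoc D⁻¹, ENNReal.inv_mul_cancel hD hD', one_mul,
      ← ENNReal.mul_rpow_of_nonneg _ _ (by positivity)]
    gcongr
    rw [mul_assoc, mul_comm K⁻¹, ← div_eq_mul_inv, ENNReal.le_div_iff_mul_le (.inl hK) (.inl hK'),
      mul_comm,
      ← lintegral_rpow_mul_sum_threshold (σ := σ) hρ hM.le hw s a,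
      ← lintegral_const_mul' _ _ (by finiteness)]
    refine setLIntegral_mono_ae' measurableSet_Ioi (.of_forall fun t ht => ?_)
    rw [mul_left_comm]
    gcongr
    set S := s.filter fun j => t < M * |a j| * w j ^ (-1 / σ)
    rcases S.eq_empty_or_nonempty with hS | hS
    · simp [hS]
    · have hj : S.min' hS ∈ s ∧ t < M * |a (S.min' hS)| * w (S.min' hS) ^ (-1 / σ) := by
        simpa only [S, Finset.mem_filter] using S.min'_mem hS
      have h := ENNReal.rpow_le_rpow (hF t ht _ hj.1 hj.2) hθ.le
      rw [ENNReal.mul_rpow_of_nonneg _ _ hθ.le] at h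
      calc _ ≤ G * ENNReal.ofReal (w (S.min' hS)) ^ (ρ / σ) := hw.sum_rpow_le hθ S hS
        _ = κ' * G * (κ ^ (ρ / σ) * ENNReal.ofReal (w (S.min' hS)) ^ (ρ / σ)) := by
            rw [show κ' * G * (κ ^ (ρ / σ) * ENNReal.ofReal (w (S.min' hS)) ^ (ρ / σ)) =
              (κ' * κ ^ (ρ / σ)) * (G * ENNReal.ofReal (w (S.min' hS)) ^ (ρ / σ)) by ring,
              ENNReal.inv_mul_cancel hκθ hκθ', one_mul]
        _ ≤ _ := by gcongr

end Comparison

/-! ### Hölder's inequality and basic facts on Lorentz norms -/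

/-- Hölder's inequality for finite sequences: the `ℓ^q` quasi-norm is at most `n^{1/q-1/r}` times
the `ℓ^r` quasi-norm. -/
theorem seqNorm_le_card_rpow_mul_seqNorm {q r : ℝ≥0∞} (hq : 0 < q) (hqr : q ≤ r)
    (s : Finset ℕ) (a : ℕ → ℝ) :
    seqNorm q s a ≤ (s.card : ℝ≥0∞) ^ ((1 / q).toReal - (1 / r).toReal) * seqNorm r s a := by
  rcases eq_or_ne q ∞ with rfl | hq'
  · obtain rfl : r = ∞ := top_le_iff.1 hqr
    simp
  have hq₀ : 0 < q.toReal := ENNReal.toReal_pos hq.ne' hq'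
  have h1q : (1 / q).toReal = 1 / q.toReal := by simp
  rcases eq_or_ne r ∞ with rfl | hr'
  · simp only [seqNorm, if_neg hq', if_true, h1q, ENNReal.div_top, ENNReal.toReal_zero, sub_zero]
    calc (∑ j ∈ s, ‖a j‖ₑ ^ q.toReal) ^ (1 / q.toReal)
        ≤ (∑ j ∈ s, (s.sup fun j => ‖a j‖ₑ) ^ q.toReal) ^ (1 / q.toReal) := by
          gcongr with j hj
          exact Finset.le_sup (f := fun j => ‖a j‖ₑ) hj
      _ = _ := by
          rw [Finset.sum_const, nsmul_eq_mul, ENNReal.mul_rpow_of_nonneg _ _ (by positivity),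
            ← ENNReal.rpow_mul, mul_one_div_cancel hq₀.ne', ENNReal.rpow_one]
  · have hqr' : q.toReal ≤ r.toReal := ENNReal.toReal_mono hr' hqr
    have hr₀ : 0 < r.toReal := hq₀.trans_le hqr'
    have h1r : (1 / r).toReal = 1 / r.toReal := by simp
    simp only [seqNorm, if_neg hq', if_neg hr', h1q, h1r]
    have h := ENNReal.rpow_sum_le_const_mul_sum_rpow s (fun j => ‖a j‖ₑ ^ q.toReal)
      ((one_le_div hq₀).2 hqr')
    have h' := ENNReal.rpow_le_rpow h (one_div_pos.2 hr₀).le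
    rw [ENNReal.mul_rpow_of_nonneg _ _ (by positivity), ← ENNReal.rpow_mul, ← ENNReal.rpow_mul] at h'
    simp only [← ENNReal.rpow_mul] at h'
    convert h' using 3
    · field_simp
    · field_simp
    · field_simp

lemma lorentzNorm_congr_ae {X : Type*} [MeasurableSpace X] {μ : Measure X} {p : ℝ} {r : ℝ≥0∞}
    {f g : X → ℝ} (h : f =ᵐ[μ] g) : lorentzNorm μ p r f = lorentzNorm μ p r g := by
  have : ∀ t : ℝ, μ {x | t < |f x|} = μ {x | t < |g x|} := fun t =>
    by
    refine measure_congr (Filter.eventuallyEq_set.2 (h.mono fun x hx => ?_))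
    simp [hx]
  simp only [lorentzNorm, this]

lemma lorentzNorm_zero {X : Type*} [MeasurableSpace X] {μ : Measure X} {p : ℝ} (hp : 0 < p)
    {r : ℝ≥0∞} (hr : 0 < r) : lorentzNorm μ p r (0 : X → ℝ) = 0 := by
  have : ∀ t : ℝ, 0 < t → μ {x | t < |(0 : X → ℝ) x|} = 0 := fun t ht => by
    simp [not_lt.2 ht.le]
  unfold lorentzNorm
  split_ifs with h
  · simp only [ENNReal.iSup_eq_zero]
    intro t ht
    rw [this t ht, ENNReal.zero_rpow_of_pos (by positivity), mul_zero]
  · have hρ : 0 < r.toReal := ENNReal.toReal_pos hr.ne' h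
    rw [setLIntegral_congr_fun (g := fun _ => 0) measurableSet_Ioi]
    · simp [hρ]
    · intro t ht
      simp only
      rw [this t ht, ENNReal.zero_rpow_of_pos (by positivity), mul_zero]

/-! ### Test functions and their weak derivatives -/

section TestFunctions

variable {d : ℕ} {Ω Ω' : Opens (EuclideanSpace ℝ (Fin d))}

/-- The `i`-th partial derivative, as a linear map on test functions. -/
def partialDeriv (i : Fin d) : 𝓓(Ω, ℝ) →ₗ[ℝ] 𝓓(Ω, ℝ) where
  toFun φ := LineDeriv.lineDerivOp (EuclideanSpace.single i (1 : ℝ)) φ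
  map_add' := LineDeriv.lineDerivOp_add _
  map_smul' _ _ := LineDeriv.lineDerivOp_smul _ _ _

lemma partialDeriv_apply (i : Fin d) (φ : 𝓓(Ω, ℝ)) (x : EuclideanSpace ℝ (Fin d)) :
    partialDeriv i φ x = lineDeriv ℝ φ x (EuclideanSpace.single i 1) := by
  have : partialDeriv i φ = TestFunction.lineDerivCLM ℝ (EuclideanSpace.single i 1) φ := rfl
  rw [this, TestFunction.lineDerivCLM_apply_of_le (by simp)]

/-- `∂_{i_k}^{α_{i_k}} ⋯ ∂_{i_1}^{α_{i_1}}` for a list `[i_1, …, i_k]` of coordinates. -/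
def listDeriv (α : Fin d → ℕ) : List (Fin d) → (𝓓(Ω, ℝ) →ₗ[ℝ] 𝓓(Ω, ℝ))
  | [] => LinearMap.id
  | i :: l => listDeriv α l ∘ₗ partialDeriv i ^ α i

/-- The derivative `∂_d^{α_d} ⋯ ∂_1^{α_1}`: the same partial derivatives as in `testDeriv`, in the
reverse order. -/
def reverseDeriv (α : Fin d → ℕ) : 𝓓(Ω, ℝ) →ₗ[ℝ] 𝓓(Ω, ℝ) := listDeriv α (List.finRange d)

lemma hasLineDerivAt_testFunction (φ : 𝓓(Ω, ℝ)) (i : Fin d) (x : EuclideanSpace ℝ (Fin d)) :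
    HasLineDerivAt ℝ φ (partialDeriv i φ x) x (EuclideanSpace.single i 1) := by
  rw [partialDeriv_apply]
  exact (φ.contDiff.differentiable (by simp) x).lineDifferentiableAt.hasLineDerivAt

lemma integrable_testFunction (φ : 𝓓(Ω, ℝ)) : Integrable φ volume :=
  φ.continuous.integrable_of_hasCompactSupport φ.hasCompactSupport

lemma integrable_mul_testFunction (φ ψ : 𝓓(Ω, ℝ)) : Integrable (fun x => φ x * ψ x) volume :=
  (φ.continuous.mul ψ.continuous).integrable_of_hasCompactSupport φ.hasCompactSupport.mul_right

lemma integral_mul_partialDeriv (i : Fin d) (φ ψ : 𝓓(Ω, ℝ)) :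
    ∫ x, φ x * partialDeriv i ψ x = -∫ x, partialDeriv i φ x * ψ x :=
  integral_bilinear_hasLineDerivAt_right_eq_neg_left_of_integrable
    (B := ContinuousLinearMap.mul ℝ ℝ) (v := EuclideanSpace.single i 1)
    (integrable_mul_testFunction _ _) (integrable_mul_testFunction _ _)
    (integrable_mul_testFunction _ _) (fun x _ => hasLineDerivAt_testFunction φ i x)
    (fun x _ => hasLineDerivAt_testFunction ψ i x)

lemma integral_mul_partialDeriv_pow (i : Fin d) (k : ℕ) (φ ψ : 𝓓(Ω, ℝ)) :
    ∫ x, φ x * (partialDeriv i ^ k) ψ x = (-1) ^ k * ∫ x, (partialDeriv i ^ k) φ x * ψ x := by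
  induction k generalizing φ with
  | zero => simp
  | succ k ih =>
    have h1 : (partialDeriv i ^ (k + 1)) ψ = partialDeriv i ((partialDeriv i ^ k) ψ) := by
      rw [pow_succ', Module.End.mul_apply]
    have h2 : (partialDeriv i ^ (k + 1)) φ = (partialDeriv i ^ k) (partialDeriv i φ) := by
      rw [pow_succ, Module.End.mul_apply]
    rw [h1, h2, integral_mul_partialDeriv, ih]
    ring

lemma testDeriv_eq_foldr (α : Fin d → ℕ) (φ : 𝓓(Ω, ℝ)) :
    testDeriv α φ = (List.finRange d).foldr (fun i ψ => (partialDeriv i ^ α i) ψ) φ := by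
  unfold testDeriv
  congr 1
  funext i ψ
  rw [Module.End.pow_apply]
  rfl

/-- Integration by parts removes the outermost derivative first, so the derivatives reach `φ` in the
reverse order. Keeping that order avoids commuting partial derivatives. -/
lemma integral_mul_foldr_partialDeriv (α : Fin d → ℕ) (l : List (Fin d)) (φ ψ : 𝓓(Ω, ℝ)) :
    ∫ x, φ x * l.foldr (fun i ψ => (partialDeriv i ^ α i) ψ) ψ x =
      (-1) ^ (l.map α).sum * ∫ x, listDeriv α l φ x * ψ x := by
  induction l generalizing φ with
  | nil => simp [listDeriv]
  | cons i l ih =>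
    rw [List.foldr_cons, integral_mul_partialDeriv_pow, ih, List.map_cons, List.sum_cons, pow_add,
      mul_assoc]
    rfl

/-- Integration by parts for test functions. -/
lemma integral_mul_testDeriv (α : Fin d → ℕ) (φ ψ : 𝓓(Ω, ℝ)) :
    ∫ x, φ x * testDeriv α ψ x = (-1) ^ (∑ i, α i) * ∫ x, reverseDeriv α φ x * ψ x := by
  rw [testDeriv_eq_foldr, integral_mul_foldr_partialDeriv, Fin.sum_univ_def]
  rfl

lemma testFunction_eq_zero_of_notMem (ψ : 𝓓(Ω, ℝ)) {x : EuclideanSpace ℝ (Fin d)} (hx : x ∉ Ω) :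
    ψ x = 0 :=
  image_eq_zero_of_notMem_tsupport fun h => hx (ψ.tsupport_subset h)

lemma testClass_coeFn (φ : 𝓓(Ω, ℝ)) :
    testClass φ =ᵐ[(volume : Measure (EuclideanSpace ℝ (Fin d))).restrict Ω] φ :=
  AEEqFun.coeFn_mk _ _

lemma integrable_testClass (φ : 𝓓(Ω, ℝ)) :
    Integrable (testClass φ) ((volume : Measure (EuclideanSpace ℝ (Fin d))).restrict Ω) :=
  (integrable_testFunction φ).restrict.congr (testClass_coeFn φ).symm

lemma locallyIntegrableOn_testClass (φ : 𝓓(Ω, ℝ)) :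
    LocallyIntegrableOn (testClass φ) Ω volume :=
  IntegrableOn.locallyIntegrableOn (integrable_testClass φ)

lemma setIntegral_mul_testFunction (f : EuclideanSpace ℝ (Fin d) → ℝ) (ψ : 𝓓(Ω, ℝ)) :
    ∫ x in (Ω : Set (EuclideanSpace ℝ (Fin d))), f x * ψ x = ∫ x, f x * ψ x :=
  setIntegral_eq_integral_of_forall_compl_eq_zero fun x hx => by
    rw [testFunction_eq_zero_of_notMem ψ hx, mul_zero]

lemma setIntegral_testClass_mul (φ ψ : 𝓓(Ω, ℝ)) :
    ∫ x in (Ω : Set (EuclideanSpace ℝ (Fin d))), testClass φ x * ψ x = ∫ x, φ x * ψ x := by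
  rw [← setIntegral_mul_testFunction]
  exact integral_congr_ae ((testClass_coeFn φ).mul .rfl)

lemma isWeakDeriv_testClass (α : Fin d → ℕ) (φ : 𝓓(Ω, ℝ)) :
    IsWeakDeriv Ω α (testClass φ) (testClass (reverseDeriv α φ)) :=
  ⟨locallyIntegrableOn_testClass _, locallyIntegrableOn_testClass _, fun ψ => by
    rw [setIntegral_testClass_mul, setIntegral_testClass_mul, integral_mul_testDeriv]⟩

lemma integrable_smul_of_locallyIntegrableOn {f ψ : EuclideanSpace ℝ (Fin d) → ℝ}
    (hf : LocallyIntegrableOn f Ω volume) (hψ : Continuous ψ) (hc : HasCompactSupport ψ)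
    (hs : tsupport ψ ⊆ Ω) : Integrable (fun x => ψ x * f x) volume := by
  have h1 : IntegrableOn f (tsupport ψ) volume := hf.integrableOn_compact_subset hs hc
  have h2 : IntegrableOn (fun x => ψ x * f x) (tsupport ψ) volume :=
    h1.continuousOn_mul hψ.continuousOn hc
  refine (integrableOn_iff_integrable_of_support_subset fun x hx => ?_).1 h2
  exact subset_tsupport ψ (left_ne_zero_of_mul hx)

/-- Weak derivatives are unique. -/
lemma IsWeakDeriv.unique {α : Fin d → ℕ} {f g h : MeasFun Ω} (hg : IsWeakDeriv Ω α f g)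
    (hh : IsWeakDeriv Ω α f h) : g = h := by
  have key : ∀ᵐ x, x ∈ (Ω : Set (EuclideanSpace ℝ (Fin d))) → g x - h x = 0 := by
    refine Ω.isOpen.ae_eq_zero_of_integral_contDiff_smul_eq_zero (hg.2.1.sub hh.2.1) ?_
    intro ψ hψ hc hs
    have e1 : ∀ k : MeasFun Ω, ∫ x in (Ω : Set (EuclideanSpace ℝ (Fin d))), k x * ψ x =
        ∫ x, ψ x * k x := fun k => by
      simp_rw [mul_comm (ψ _)]
      exact setIntegral_mul_testFunction k (⟨ψ, hψ, hc, hs⟩ : 𝓓(Ω, ℝ))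
    have e2 : ∫ x in (Ω : Set (EuclideanSpace ℝ (Fin d))), g x * ψ x =
        ∫ x in (Ω : Set (EuclideanSpace ℝ (Fin d))), h x * ψ x :=
      mul_left_cancel₀ (pow_ne_zero _ (by norm_num))
        ((hg.2.2 ⟨ψ, hψ, hc, hs⟩).symm.trans (hh.2.2 ⟨ψ, hψ, hc, hs⟩))
    simp only [smul_eq_mul, mul_sub]
    rw [integral_sub (integrable_smul_of_locallyIntegrableOn hg.2.1 hψ.continuous hc hs)
      (integrable_smul_of_locallyIntegrableOn hh.2.1 hψ.continuous hc hs), ← e1, ← e1, e2, sub_self]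
  refine AEEqFun.ext ((ae_restrict_iff' Ω.isOpen.measurableSet).2 ?_)
  filter_upwards [key] with x hx hxΩ
  exact sub_eq_zero.1 (hx hxΩ)

lemma lorentzNormOn_testClass (p : ℝ) (r : ℝ≥0∞) (φ : 𝓓(Ω, ℝ)) :
    lorentzNormOn Ω p r (testClass φ) =
      lorentzNorm ((volume : Measure (EuclideanSpace ℝ (Fin d))).restrict Ω) p r φ :=
  lorentzNorm_congr_ae (testClass_coeFn φ)

/-- By uniqueness of weak derivatives the infimum runs over one function only, the classical
derivative. -/
lemma weakDerivNorm_testClass (p : ℝ) (r : ℝ≥0∞) (α : Fin d → ℕ) (φ : 𝓓(Ω, ℝ)) :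
    weakDerivNorm Ω p r α (testClass φ) =
      lorentzNorm ((volume : Measure (EuclideanSpace ℝ (Fin d))).restrict Ω) p r
        (reverseDeriv α φ) := by
  rw [← lorentzNormOn_testClass]
  refine le_antisymm (iInf₂_le _ (isWeakDeriv_testClass α φ)) (le_iInf₂ fun g hg => ?_)
  rw [hg.unique (isWeakDeriv_testClass α φ)]

/-- The linear map from test functions to their classes. -/
def testClassLinear : 𝓓(Ω, ℝ) →ₗ[ℝ] MeasFun Ω where
  toFun := testClass
  map_add' _ _ := rfl
  map_smul' _ _ := rfl

lemma sobolevNorm_testClass_zero {m : ℕ} {p : ℝ} (hp : 0 < p) {r : ℝ≥0∞} (hr : 0 < r) :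
    sobolevNorm Ω m p r (testClass 0) = 0 := by
  unfold sobolevNorm
  refine Finset.sum_eq_zero fun k _ => Finset.sum_eq_zero fun α _ => ?_
  rw [weakDerivNorm_testClass, map_zero]
  exact lorentzNorm_zero hp hr

lemma testClass_mem_sobolevSpaceZero {m : ℕ} {p : ℝ} (hp : 0 < p) {r : ℝ≥0∞} (hr : 0 < r)
    {φ : 𝓓(Ω, ℝ)} (hφ : sobolevNorm Ω m p r (testClass φ) < ∞) :
    testClass φ ∈ sobolevSpaceZero Ω m p r := by
  refine ⟨⟨integrable_testClass φ, hφ⟩, fun ε hε => ⟨φ, ?_⟩⟩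
  have : testClass φ - testClass φ = testClass (0 : 𝓓(Ω, ℝ)) := by
    rw [sub_self]
    exact (map_zero testClassLinear).symm
  rwa [this, sobolevNorm_testClass_zero hp hr]

/-- A test function with vanishing `i`-th derivative is constant on lines in that direction, and
each such line leaves the compact support. This keeps the derivative of order `m` of the bump from
vanishing. -/
lemma partialDeriv_injective (i : Fin d) :
    Function.Injective (partialDeriv i : 𝓓(Ω, ℝ) →ₗ[ℝ] 𝓓(Ω, ℝ)) := by
  refine (injective_iff_map_eq_zero _).2 fun φ hφ => TestFunction.ext fun x => ?_
  set v : EuclideanSpace ℝ (Fin d) := EuclideanSpace.single i 1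
  have hv : ‖v‖ = 1 := by simp [v]
  have hderiv : ∀ t : ℝ, HasDerivAt (fun t : ℝ => φ (x + t • v)) 0 t := by
    intro t
    have h := hasLineDerivAt_testFunction φ i (x + t • v)
    rw [hφ] at h
    have h' : HasDerivAt (fun s : ℝ => φ (x + t • v + s • v)) 0 (t - t) := by
      rw [sub_self]; exact h
    have h2 := h'.comp_sub_const t t
    refine h2.congr_of_eventuallyEq (.of_forall fun s => ?_)
    simp only [add_assoc, ← add_smul, add_sub_cancel]
  have hconst := is_const_of_deriv_eq_zero (fun t => (hderiv t).differentiableAt)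
    fun t => (hderiv t).deriv
  obtain ⟨R, hR⟩ := φ.hasCompactSupport.isCompact.isBounded.subset_closedBall (0 : _)
  -- Moving by `‖x‖ + |R| + 1` along a unit vector ends at norm at least `|R| + 1`, outside the ball
  -- of radius `R`.
  have h0 : φ (x + (‖x‖ + |R| + 1) • v) = 0 := by
    refine image_eq_zero_of_notMem_tsupport fun h => ?_
    have h1 := hR h
    rw [mem_closedBall_zero_iff] at h1
    have h2 : ‖(‖x‖ + |R| + 1) • v‖ = ‖x‖ + |R| + 1 := by
      rw [norm_smul, hv, mul_one, Real.norm_of_nonneg (by positivity)]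
    have h3 := norm_le_add_norm_add' x ((‖x‖ + |R| + 1) • v)
    have := norm_sub_le (x + (‖x‖ + |R| + 1) • v) x
    rw [add_sub_cancel_left] at this
    linarith [le_abs_self R]
  have := hconst 0 (‖x‖ + |R| + 1)
  simp only [zero_smul, add_zero] at this
  rw [this, h0]
  rfl

lemma listDeriv_injective (α : Fin d → ℕ) (l : List (Fin d)) :
    Function.Injective (listDeriv α l : 𝓓(Ω, ℝ) →ₗ[ℝ] 𝓓(Ω, ℝ)) := by
  induction l with
  | nil => exact Function.injective_id
  | cons i l ih =>
    refine ih.comp ?_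
    rw [Module.End.coe_pow]
    exact (partialDeriv_injective i).iterate _

lemma tsupport_partialDeriv_subset (i : Fin d) (φ : 𝓓(Ω, ℝ)) :
    tsupport (partialDeriv i φ) ⊆ tsupport φ := by
  refine closure_minimal (fun x hx => ?_) (isClosed_tsupport φ)
  by_contra h
  refine hx ?_
  rw [partialDeriv_apply]
  have : φ =ᶠ[nhds x] fun _ => 0 := notMem_tsupport_iff_eventuallyEq.1 h
  rw [this.lineDeriv_eq]
  exact deriv_const _ _

lemma tsupport_listDeriv_subset (α : Fin d → ℕ) (l : List (Fin d)) (φ : 𝓓(Ω, ℝ)) :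
    tsupport (listDeriv α l φ) ⊆ tsupport φ := by
  have hpow : ∀ (i : Fin d) (k : ℕ) (φ : 𝓓(Ω, ℝ)),
      tsupport ((partialDeriv i ^ k) φ) ⊆ tsupport φ := by
    intro i k
    induction k with
    | zero => intro φ; exact subset_rfl
    | succ k ih =>
      intro φ
      rw [pow_succ, Module.End.mul_apply]
      exact (ih _).trans (tsupport_partialDeriv_subset i φ)
  induction l generalizing φ with
  | nil => exact subset_rfl
  | cons i l ih => exact (ih _).trans (hpow i _ φ)

/-! ### Derivatives under translation and dilation -/

section Scaling

variable {c L : ℝ} {y : EuclideanSpace ℝ (Fin d)} {f : 𝓓(Ω, ℝ)} {g : 𝓓(Ω', ℝ)}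

lemma partialDeriv_scaling (hfg : ∀ x, f x = c * g (L • (x - y))) (i : Fin d)
    (x : EuclideanSpace ℝ (Fin d)) :
    partialDeriv i f x = c * L * partialDeriv i g (L • (x - y)) := by
  set v : EuclideanSpace ℝ (Fin d) := EuclideanSpace.single i 1
  have hg := hasLineDerivAt_testFunction g i (L • (x - y))
  have h1 : HasDerivAt (fun t : ℝ => g (L • (x - y) + t • v)) (partialDeriv i g (L • (x - y)))
      (L * 0) := by
    rw [mul_zero]; exact hg
  have h2 := (h1.comp (0 : ℝ) ((hasDerivAt_id (0 : ℝ)).const_mul L)).const_mul c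
  have h3 : HasLineDerivAt ℝ f (c * (partialDeriv i g (L • (x - y)) * (L * 1))) x v := by
    refine HasDerivAt.congr_of_eventuallyEq h2 (.of_forall fun t => ?_)
    simp only [hfg, Function.comp_apply]
    congr 2
    rw [mul_smul, ← smul_add, add_sub_right_comm]
  rw [partialDeriv_apply, h3.lineDeriv]
  ring

lemma partialDeriv_pow_scaling (hfg : ∀ x, f x = c * g (L • (x - y))) (i : Fin d) (k : ℕ)
    (x : EuclideanSpace ℝ (Fin d)) :
    (partialDeriv i ^ k) f x = c * L ^ k * (partialDeriv i ^ k) g (L • (x - y)) := by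
  induction k generalizing x with
  | zero => simpa using hfg x
  | succ k ih =>
    rw [pow_succ' (partialDeriv i), pow_succ' (partialDeriv i), Module.End.mul_apply,
      Module.End.mul_apply, partialDeriv_scaling ih]
    ring

lemma listDeriv_scaling (hfg : ∀ x, f x = c * g (L • (x - y))) (α : Fin d → ℕ)
    (l : List (Fin d)) (x : EuclideanSpace ℝ (Fin d)) :
    listDeriv α l f x = c * L ^ (l.map α).sum * listDeriv α l g (L • (x - y)) := by
  induction l generalizing f g c with
  | nil => simpa [listDeriv] using hfg x
  | cons i l ih =>
    have h := ih (partialDeriv_pow_scaling hfg i (α i))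
    rw [List.map_cons, List.sum_cons, pow_add, ← mul_assoc]
    exact h

lemma reverseDeriv_scaling (hfg : ∀ x, f x = c * g (L • (x - y))) (α : Fin d → ℕ)
    (x : EuclideanSpace ℝ (Fin d)) :
    reverseDeriv α f x = c * L ^ (∑ i, α i) * reverseDeriv α g (L • (x - y)) := by
  rw [Fin.sum_univ_def]
  exact listDeriv_scaling hfg α _ x

end Scaling

end TestFunctions

/-! ### Disjoint balls and Lorentz norms of sums of bumps -/

/-- Pairwise disjoint closed balls with centres `y j` and radii `1 / L j ≤ 1` in `Ω`, the radii
decreasing geometrically. -/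
structure BallFamily {d : ℕ} (Ω : Opens (EuclideanSpace ℝ (Fin d)))
    (y : ℕ → EuclideanSpace ℝ (Fin d)) (L : ℕ → ℝ) : Prop where
  one_le : ∀ j, 1 ≤ L j
  two_mul_le : ∀ j, 2 * L j ≤ L (j + 1)
  disjoint : ∀ i j, i ≠ j →
    Disjoint (Metric.closedBall (y i) (L i)⁻¹) (Metric.closedBall (y j) (L j)⁻¹)
  subset : ∀ j, Metric.closedBall (y j) (L j)⁻¹ ⊆ (Ω : Set (EuclideanSpace ℝ (Fin d)))

/-- The centres approach `x₀` along a segment at distance `ρ 2^{-j} / 2`, with radii `ρ 2^{-j} / 8`.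
For `i < j` the centres are at least `ρ 2^{-i} / 4` apart, and the radii add up to at most `3 ρ
2^{-i} / 16`. -/
theorem exists_ballFamily {d : ℕ} (hd : 1 ≤ d) (Ω : Opens (EuclideanSpace ℝ (Fin d)))
    (hΩ : (Ω : Set (EuclideanSpace ℝ (Fin d))).Nonempty) :
    ∃ y L, BallFamily Ω y L := by
  obtain ⟨x₀, hx₀⟩ := hΩ
  obtain ⟨ρ₀, hρ₀, hball⟩ := Metric.isOpen_iff.1 Ω.isOpen x₀ hx₀
  set ρ := min ρ₀ 1
  have hρ : 0 < ρ := lt_min hρ₀ one_pos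
  have hρ1 : ρ ≤ 1 := min_le_right _ _
  have hρρ : ρ ≤ ρ₀ := min_le_left _ _
  set e : EuclideanSpace ℝ (Fin d) := EuclideanSpace.single ⟨0, hd⟩ 1
  have he : ‖e‖ = 1 := by simp [e]
  have hL : ∀ j : ℕ, (8 * 2 ^ j / ρ)⁻¹ = ρ * (1 / 2) ^ j / 8 := fun j => by
    rw [one_div, inv_pow]
    field_simp
  have hdisj : ∀ i j : ℕ, i < j →
      Disjoint (Metric.closedBall (x₀ + (ρ * (1 / 2) ^ i / 2) • e) (8 * 2 ^ i / ρ)⁻¹)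
        (Metric.closedBall (x₀ + (ρ * (1 / 2) ^ j / 2) • e) (8 * 2 ^ j / ρ)⁻¹) := by
    intro i j hij
    apply Metric.closedBall_disjoint_closedBall
    rw [hL, hL, dist_add_left, dist_eq_norm, ← sub_smul, norm_smul, he, mul_one]
    have h1 : (1 / 2 : ℝ) ^ j ≤ (1 / 2) ^ i * (1 / 2) := by
      rw [← pow_succ]
      exact pow_le_pow_of_le_one (by norm_num) (by norm_num) hij
    have h2 : ρ * (1 / 2) ^ j ≤ ρ * (1 / 2) ^ i * (1 / 2) := by
      rw [mul_assoc]
      exact mul_le_mul_of_nonneg_left h1 hρ.le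
    have h3 : 0 < ρ * (1 / 2) ^ i := by positivity
    refine lt_of_lt_of_le ?_ (le_abs_self _)
    linarith
  refine ⟨fun j => x₀ + (ρ * (1 / 2) ^ j / 2) • e, fun j => 8 * 2 ^ j / ρ, ?_, ?_, ?_, ?_⟩
  · intro j
    rw [le_div_iff₀ hρ]
    have : (1 : ℝ) ≤ 2 ^ j := one_le_pow₀ (by norm_num)
    linarith
  · intro j
    rw [pow_succ]
    exact le_of_eq (by ring)
  · intro i j hij
    rcases lt_or_gt_of_ne hij with h | h
    · exact hdisj i j h
    · exact (hdisj j i h).symm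
  · intro j
    refine subset_trans ?_ hball
    refine Metric.closedBall_subset_ball' ?_
    rw [hL, dist_self_add_left, norm_smul, he, mul_one]
    have h1 : (1 / 2 : ℝ) ^ j ≤ 1 := pow_le_one₀ (by norm_num) (by norm_num)
    have h2 : ρ * (1 / 2) ^ j ≤ ρ := mul_le_of_le_one_right hρ.le h1
    rw [Real.norm_of_nonneg (by positivity)]
    linarith

namespace BallFamily

variable {d : ℕ} {Ω : Opens (EuclideanSpace ℝ (Fin d))} {y : ℕ → EuclideanSpace ℝ (Fin d)}
  {L : ℕ → ℝ} (hB : BallFamily Ω y L)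
include hB

lemma pos (j : ℕ) : 0 < L j := one_pos.trans_le (hB.one_le j)

lemma halving (hd : 1 ≤ d) : Halving fun j => (L j ^ d)⁻¹ where
  pos j := inv_pos.2 (pow_pos (hB.pos j) d)
  succ_le j := by
    have h0 := hB.pos j
    have h : 2 * L j ^ d ≤ L (j + 1) ^ d := by
      calc 2 * L j ^ d ≤ 2 ^ d * L j ^ d := by
            gcongr
            exact le_self_pow₀ (by norm_num) (by omega)
        _ = (2 * L j) ^ d := (mul_pow _ _ _).symm
        _ ≤ _ := by
            gcongr
            exact hB.two_mul_le j
    calc (L (j + 1) ^ d)⁻¹ ≤ (2 * L j ^ d)⁻¹ := by gcongr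
      _ = (L j ^ d)⁻¹ / 2 := by
        rw [mul_inv]
        ring

lemma smul_sub_mem_closedBall_iff (j : ℕ) (x : EuclideanSpace ℝ (Fin d)) :
    L j • (x - y j) ∈ Metric.closedBall (0 : EuclideanSpace ℝ (Fin d)) 1 ↔
      x ∈ Metric.closedBall (y j) (L j)⁻¹ := by
  rw [mem_closedBall_zero_iff, norm_smul, Real.norm_of_nonneg (hB.pos j).le, Metric.mem_closedBall,
    dist_eq_norm, mul_comm, ← le_div_iff₀ (hB.pos j), one_div]

lemma volume_preimage_smul_sub (j : ℕ) (S : Set (EuclideanSpace ℝ (Fin d))) :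
    volume {x | L j • (x - y j) ∈ S} = ENNReal.ofReal (L j ^ d)⁻¹ * volume S := by
  have h : {x | L j • (x - y j) ∈ S} = MeasurableEquiv.subRight (y j) ⁻¹' ((L j • ·) ⁻¹' S) := rfl
  rw [h, (measurePreserving_sub_right volume (y j)).measure_preimage_equiv
    (f := MeasurableEquiv.subRight (y j)), Measure.addHaar_preimage_smul _ (hB.pos j).ne',
    finrank_euclideanSpace_fin, abs_of_pos (inv_pos.2 (pow_pos (hB.pos j) d))]

variable (hd : 1 ≤ d) {g : EuclideanSpace ℝ (Fin d) → ℝ}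
  (hg : ∀ x, x ∉ Metric.closedBall (0 : EuclideanSpace ℝ (Fin d)) 1 → g x = 0)
  {σ : ℝ} (hσ : 0 < σ) {r : ℝ≥0∞} (hr : 0 < r)
include hg

lemma sum_apply_of_mem {s : Finset ℕ} (b : ℕ → ℝ) {j : ℕ} (hj : j ∈ s)
    {x : EuclideanSpace ℝ (Fin d)} (hx : x ∈ Metric.closedBall (y j) (L j)⁻¹) :
    ∑ i ∈ s, b i * g (L i • (x - y i)) = b j * g (L j • (x - y j)) := by
  refine Finset.sum_eq_single_of_mem j hj fun i _ hij => ?_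
  have : x ∉ Metric.closedBall (y i) (L i)⁻¹ :=
    Set.disjoint_right.1 (hB.disjoint i j hij) hx
  rw [hg _ (mt (hB.smul_sub_mem_closedBall_iff i x).1 this), mul_zero]

include hd hσ hr

theorem exists_lorentzNorm_sum_le {M : ℝ} (hM : 0 < M) (hgM : ∀ x, |g x| ≤ M) :
    ∃ C : ℝ≥0∞, C ≠ ∞ ∧ ∀ (s : Finset ℕ) (a A : ℕ → ℝ),
      (∀ j, |A j| ≤ (L j ^ d)⁻¹ ^ (-1 / σ)) →
      lorentzNorm ((volume : Measure (EuclideanSpace ℝ (Fin d))).restrict Ω) σ r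
        (fun x => ∑ j ∈ s, a j * A j * g (L j • (x - y j))) ≤ C * seqNorm r s a := by
  obtain ⟨C, hC, h⟩ := exists_lorentzNorm_le_seqNorm
    ((volume : Measure (EuclideanSpace ℝ (Fin d))).restrict Ω) hσ hr (hB.halving hd) hM
    (A := volume (Metric.closedBall (0 : EuclideanSpace ℝ (Fin d)) 1))
    measure_closedBall_lt_top.ne
  refine ⟨C, hC, fun s a A hA => h s a _ fun t ht => ?_⟩
  refine (Measure.restrict_apply_le _ _).trans ?_
  -- The balls are disjoint, so at most one summand is non-zero at `x`; if the sum exceeds `t`, that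
  -- summand does, which forces `t` below its threshold.
  have hsub : {x | t < |∑ j ∈ s, a j * A j * g (L j • (x - y j))|} ⊆
      ⋃ j ∈ s.filter (fun j => t < M * |a j| * (L j ^ d)⁻¹ ^ (-1 / σ)),
        {x | L j • (x - y j) ∈ Metric.closedBall (0 : EuclideanSpace ℝ (Fin d)) 1} := by
    intro x hx
    have hx' : t < |∑ j ∈ s, a j * A j * g (L j • (x - y j))| := hx
    have hne : ∑ j ∈ s, a j * A j * g (L j • (x - y j)) ≠ 0 := by
      intro h0
      rw [h0, abs_zero] at hx'
      exact hx'.not_gt ht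
    obtain ⟨j, hj, hj0⟩ := Finset.exists_ne_zero_of_sum_ne_zero hne
    have hmem : L j • (x - y j) ∈ Metric.closedBall (0 : EuclideanSpace ℝ (Fin d)) 1 := by
      by_contra hcon
      exact hj0 (by rw [hg _ hcon, mul_zero])
    rw [hB.sum_apply_of_mem hg (fun j => a j * A j) hj
      ((hB.smul_sub_mem_closedBall_iff j x).1 hmem), abs_mul, abs_mul] at hx'
    refine Set.mem_biUnion (x := j) (Finset.mem_filter.2 ⟨hj, hx'.trans_le ?_⟩) hmem
    calc |a j| * |A j| * |g (L j • (x - y j))|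
        ≤ |a j| * (L j ^ d)⁻¹ ^ (-1 / σ) * M := by
          gcongr
          · exact mul_nonneg (abs_nonneg _) ((abs_nonneg _).trans (hA j))
          · exact hA j
          · exact hgM _
      _ = _ := by ring
  refine (measure_mono hsub).trans ((measure_biUnion_finset_le _ _).trans ?_)
  rw [Finset.mul_sum]
  refine Finset.sum_le_sum fun j _ => ?_
  rw [hB.volume_preimage_smul_sub, mul_comm]

theorem exists_seqNorm_le_lorentzNorm_sum (hgc : Continuous g) (hg0 : g ≠ 0) :
    ∃ C : ℝ≥0∞, C ≠ ∞ ∧ ∀ (s : Finset ℕ) (a A : ℕ → ℝ),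
      (∀ j, A j = (L j ^ d)⁻¹ ^ (-1 / σ)) →
      seqNorm r s a ≤ C * lorentzNorm
        ((volume : Measure (EuclideanSpace ℝ (Fin d))).restrict Ω) σ r
        (fun x => ∑ j ∈ s, a j * A j * g (L j • (x - y j))) := by
  obtain ⟨x₀, hx₀⟩ := Function.ne_iff.1 hg0
  have hx₀' : 0 < |g x₀| := abs_pos.2 hx₀
  -- The set where `|g|` exceeds half of a non-zero value is open and non-empty, so its measure is
  -- positive. Its rescaled copies lie in the balls and supply the lower bounds for the distribution
  -- function.
  set η := |g x₀| / 2
  have hη : 0 < η := half_pos hx₀'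
  set E : Set (EuclideanSpace ℝ (Fin d)) := {x | η < |g x|}
  have hEo : IsOpen E := isOpen_lt continuous_const hgc.abs
  have hE1 : E ⊆ Metric.closedBall (0 : EuclideanSpace ℝ (Fin d)) 1 := by
    intro x hx
    by_contra hcon
    have hx' : η < |g x| := hx
    rw [hg x hcon, abs_zero] at hx'
    exact hx'.not_gt hη
  have hE0 : volume E ≠ 0 := (hEo.measure_pos volume ⟨x₀, half_lt_self hx₀'⟩).ne'
  have hE : volume E ≠ ∞ := ((measure_mono hE1).trans_lt measure_closedBall_lt_top).ne
  obtain ⟨C, hC, h⟩ := exists_seqNorm_le_lorentzNorm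
    ((volume : Measure (EuclideanSpace ℝ (Fin d))).restrict Ω) hσ hr (hB.halving hd) hη hE0 hE
  refine ⟨C, hC, fun s a A hA => h s a _ fun t ht j hj htj => ?_⟩
  rw [mul_comm, ← hB.volume_preimage_smul_sub]
  have hΩ : {x | L j • (x - y j) ∈ E} ⊆ (Ω : Set (EuclideanSpace ℝ (Fin d))) := fun x hx =>
    hB.subset j ((hB.smul_sub_mem_closedBall_iff j x).1 (hE1 hx))
  rw [← Measure.restrict_eq_self volume hΩ]
  refine measure_mono fun x hx => ?_
  have hx' : η < |g (L j • (x - y j))| := hx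
  change t < |∑ j ∈ s, a j * A j * g (L j • (x - y j))|
  rw [hB.sum_apply_of_mem hg (fun j => a j * A j) hj
    ((hB.smul_sub_mem_closedBall_iff j x).1 (hE1 hx)), abs_mul, abs_mul, hA]
  have hw : 0 < (L j ^ d)⁻¹ ^ (-1 / σ) := Real.rpow_pos_of_pos ((hB.halving hd).pos j) _
  rw [abs_of_pos hw]
  calc t < η * |a j| * (L j ^ d)⁻¹ ^ (-1 / σ) := htj
    _ = |a j| * (L j ^ d)⁻¹ ^ (-1 / σ) * η := by ring
    _ ≤ _ := by gcongr

end BallFamily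

/-! ### Rescaled bumps -/

/-- There is a non-zero test function supported in the closed unit ball. -/
theorem exists_testFunction_closedBall (d : ℕ) :
    ∃ φ : 𝓓((⊤ : Opens (EuclideanSpace ℝ (Fin d))), ℝ), φ ≠ 0 ∧
      tsupport φ ⊆ Metric.closedBall 0 1 := by
  let b : ContDiffBump (0 : EuclideanSpace ℝ (Fin d)) := ⟨1 / 2, 1, by norm_num, by norm_num⟩
  refine ⟨⟨b, b.contDiff, b.hasCompactSupport, fun _ _ => trivial⟩, fun h => ?_, b.tsupport_eq.le⟩
  have h0 : b 0 = 0 := congrArg (fun φ : 𝓓((⊤ : Opens (EuclideanSpace ℝ (Fin d))), ℝ) => φ 0) h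
  rw [b.one_of_mem_closedBall (by simp [b])] at h0
  exact one_ne_zero h0

section ScaledBump

variable {d : ℕ} {Ω : Opens (EuclideanSpace ℝ (Fin d))} {y : ℕ → EuclideanSpace ℝ (Fin d)}
  {L : ℕ → ℝ} (hB : BallFamily Ω y L) {φ : 𝓓((⊤ : Opens (EuclideanSpace ℝ (Fin d))), ℝ)}
  (hφ : tsupport φ ⊆ Metric.closedBall 0 1)

/-- The test function `c φ(L_j (x - y_j))` on `Ω`. -/
def scaledBump (c : ℝ) (j : ℕ) : 𝓓(Ω, ℝ) where
  toFun x := c * φ (L j • (x - y j))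
  contDiff' := by
    have h := φ.contDiff
    exact contDiff_const.mul (h.comp ((contDiff_id.sub contDiff_const).const_smul _))
  hasCompactSupport' := by
    refine HasCompactSupport.intro (isCompact_closedBall (y j) (L j)⁻¹) fun x hx => ?_
    rw [image_eq_zero_of_notMem_tsupport
      fun h => hx ((hB.smul_sub_mem_closedBall_iff j x).1 (hφ h)), mul_zero]
  tsupport_subset' := by
    refine (closure_minimal (fun x hx => ?_) Metric.isClosed_closedBall).trans (hB.subset j)
    by_contra hcon
    refine hx ?_
    simp only
    rw [image_eq_zero_of_notMem_tsupport
      fun h => hcon ((hB.smul_sub_mem_closedBall_iff j x).1 (hφ h)), mul_zero]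

lemma scaledBump_apply (c : ℝ) (j : ℕ) (x : EuclideanSpace ℝ (Fin d)) :
    scaledBump hB hφ c j x = c * φ (L j • (x - y j)) := rfl

lemma reverseDeriv_sum_scaledBump_apply (α : Fin d → ℕ) (c : ℕ → ℝ) (s : Finset ℕ) (a : ℕ → ℝ)
    (x : EuclideanSpace ℝ (Fin d)) :
    reverseDeriv α (∑ j ∈ s, a j • scaledBump hB hφ (c j) j) x =
      ∑ j ∈ s, a j * (c j * L j ^ (∑ i, α i)) * reverseDeriv α φ (L j • (x - y j)) := by
  rw [map_sum, FunLike.coe_sum, Finset.sum_apply]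
  refine Finset.sum_congr rfl fun j _ => ?_
  rw [map_smul]
  change a j * reverseDeriv α (scaledBump hB hφ (c j) j) x = _
  rw [reverseDeriv_scaling (scaledBump_apply hB hφ (c j) j), mul_assoc (a j)]

end ScaledBump

/-! ### The bump sequence -/

lemma seqNorm_ne_top (r : ℝ≥0∞) (s : Finset ℕ) (a : ℕ → ℝ) : seqNorm r s a ≠ ∞ := by
  unfold seqNorm
  split_ifs
  · exact ((Finset.sup_lt_iff (by simp)).2 fun j _ => enorm_lt_top).ne
  · refine ENNReal.rpow_ne_top_of_nonneg (by positivity) (ENNReal.sum_ne_top.2 fun j _ => ?_)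
    exact ENNReal.rpow_ne_top_of_nonneg ENNReal.toReal_nonneg enorm_ne_top

lemma eq_zero_of_seqNorm_eq_zero {r : ℝ≥0∞} (hr : 0 < r) {s : Finset ℕ} {a : ℕ → ℝ}
    (h : seqNorm r s a = 0) {j : ℕ} (hj : j ∈ s) : a j = 0 := by
  unfold seqNorm at h
  split_ifs at h with hr'
  · have := (Finset.le_sup (f := fun j => ‖a j‖ₑ) hj).trans h.le
    simpa using this
  · have hρ : 0 < r.toReal := ENNReal.toReal_pos hr.ne' hr'
    have h1 := (ENNReal.rpow_eq_zero_iff_of_pos (one_div_pos.2 hρ)).1 h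
    have h2 := Finset.sum_eq_zero_iff.1 h1 j hj
    simpa [hρ, hρ.not_gt] using h2

lemma inv_pow_rpow_neg_one_div {d : ℕ} {x σ : ℝ} (hx : 0 < x) :
    (x ^ d)⁻¹ ^ (-1 / σ) = x ^ (d / σ) := by
  rw [Real.inv_rpow (by positivity), ← Real.rpow_neg (by positivity), ← Real.rpow_natCast,
    ← Real.rpow_mul hx.le]
  congr 1
  ring

lemma sobolevConj_pos {d m : ℕ} {p : ℝ} (hd : 0 < d) (hp : 0 < p) (hmp : m * p < d) :
    0 < sobolevConj d m p := by
  have : (0 : ℝ) < d := Nat.cast_pos.2 hd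
  exact div_pos (by positivity) (by linarith)

/-- This is the scale invariance that defines `p*`: the normalising powers of `L` in the two spaces
differ by the factor `L ^ m` produced by `m` derivatives. -/
lemma div_sobolevConj {d m : ℕ} {p : ℝ} (hd : 0 < d) (hp : 0 < p) (hmp : m * p < d) :
    d / sobolevConj d m p + m = d / p := by
  have hd' : (0 : ℝ) < d := Nat.cast_pos.2 hd
  have : (d : ℝ) - m * p ≠ 0 := by linarith
  unfold sobolevConj
  field_simp
  ring

lemma weakDerivNorm_le_sobolevNorm {d : ℕ} (Ω : Opens (EuclideanSpace ℝ (Fin d))) {m : ℕ} (p : ℝ)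
    (r : ℝ≥0∞) {α : Fin d → ℕ} (hα : ∑ i, α i = m) (f : MeasFun Ω) :
    weakDerivNorm Ω p r α f ≤ sobolevNorm Ω m p r f := by
  have h1 : weakDerivNorm Ω p r α f ≤
      ∑ β ∈ Finset.piAntidiag (Finset.univ : Finset (Fin d)) m, weakDerivNorm Ω p r β f :=
    Finset.single_le_sum (f := fun β => weakDerivNorm Ω p r β f) (fun _ _ => zero_le)
      (by simp [hα])
  exact h1.trans (Finset.single_le_sum
    (f := fun k => ∑ β ∈ Finset.piAntidiag (Finset.univ : Finset (Fin d)) k,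
      weakDerivNorm Ω p r β f) (fun _ _ => zero_le) (Finset.self_mem_range_succ m))

lemma exists_forall_abs_le {d : ℕ} {Ω : Opens (EuclideanSpace ℝ (Fin d))} (φ : 𝓓(Ω, ℝ)) :
    ∃ M : ℝ, 0 < M ∧ ∀ x, |φ x| ≤ M := by
  obtain ⟨M, hM⟩ := φ.continuous.bounded_above_of_compact_support φ.hasCompactSupport
  exact ⟨max M 1, by positivity, fun x => (hM x).trans (le_max_left _ _)⟩

/-- A sequence in `W₀^m L^{p,q}(Ω)` on whose finite linear combinations the norm of
`W^m L^{p,q}(Ω)` is equivalent to the `ℓ^q` norm and the norm of `L^{p*,r}(Ω)` to the `ℓ^r` norm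
of the coefficients. -/
theorem exists_bump_sequence {d m : ℕ} {p : ℝ} (hd : 0 < d) (hp : 0 < p)
    (hmp : m * p < d) {q r : ℝ≥0∞} (hq : 0 < q) (hr : 0 < r)
    (Ω : Opens (EuclideanSpace ℝ (Fin d))) (hΩ : (Ω : Set (EuclideanSpace ℝ (Fin d))).Nonempty) :
    ∃ v : ℕ → MeasFun Ω, ∃ C : ℝ≥0, 0 < C ∧ LinearIndependent ℝ v ∧ ∀ l : ℕ →₀ ℝ,
      Finsupp.linearCombination ℝ v l ∈ sobolevSpaceZero Ω m p q ∧
      sobolevNorm Ω m p q (Finsupp.linearCombination ℝ v l) ≤ C * seqNorm q l.support l ∧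
      seqNorm q l.support l ≤ C * sobolevNorm Ω m p q (Finsupp.linearCombination ℝ v l) ∧
      lorentzNormOn Ω (sobolevConj d m p) r (Finsupp.linearCombination ℝ v l) ≤
        C * seqNorm r l.support l ∧
      seqNorm r l.support l ≤
        C * lorentzNormOn Ω (sobolevConj d m p) r (Finsupp.linearCombination ℝ v l) := by
  obtain ⟨y, L, hB⟩ := exists_ballFamily hd Ω hΩ
  obtain ⟨φ, hφ0, hφ⟩ := exists_testFunction_closedBall d
  have hconj := sobolevConj_pos hd hp hmp
  set σ := sobolevConj d m p
  -- This height normalises the bumps in `L^{p*,r}`; by `hcm` it also normalises their derivatives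
  -- of order `m` in `L^{p,q}`.
  let c : ℕ → ℝ := fun j => (L j ^ d)⁻¹ ^ (-1 / σ)
  have hc : ∀ j, c j = L j ^ (d / σ) := fun j => inv_pow_rpow_neg_one_div (hB.pos j)
  have hcm : ∀ j, c j * L j ^ m = (L j ^ d)⁻¹ ^ (-1 / p) := fun j => by
    rw [hc, inv_pow_rpow_neg_one_div (hB.pos j), ← div_sobolevConj hd hp hmp,
      Real.rpow_add (hB.pos j), Real.rpow_natCast]
  -- Derivatives of lower order carry fewer factors `L j ≥ 1`; this is why the radii are at most 1.
  have hck : ∀ k ≤ m, ∀ j, |c j * L j ^ k| ≤ (L j ^ d)⁻¹ ^ (-1 / p) := fun k hk j => by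
    have h0 := hB.pos j
    have h1 : 0 < c j := by rw [hc]; positivity
    rw [← hcm, abs_of_pos (by positivity)]
    gcongr
    exact hB.one_le j
  let Φ : Finset ℕ → (ℕ → ℝ) → 𝓓(Ω, ℝ) := fun s a => ∑ j ∈ s, a j • scaledBump hB hφ (c j) j
  have hvanish : ∀ α : Fin d → ℕ, ∀ x, x ∉ Metric.closedBall (0 : EuclideanSpace ℝ (Fin d)) 1 →
      reverseDeriv α φ x = 0 := fun α x hx =>
    image_eq_zero_of_notMem_tsupport fun h => hx (hφ (tsupport_listDeriv_subset α _ φ h))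
  have hder : ∀ α s a, (reverseDeriv α (Φ s a) : EuclideanSpace ℝ (Fin d) → ℝ) = fun x =>
      ∑ j ∈ s, a j * (c j * L j ^ (∑ i, α i)) * reverseDeriv α φ (L j • (x - y j)) :=
    fun α s a => funext fun x => reverseDeriv_sum_scaledBump_apply hB hφ α c s a x
  -- upper bounds for the derivatives
  have hU : ∀ α : Fin d → ℕ, ∃ C : ℝ≥0∞, C ≠ ∞ ∧ (∑ i, α i ≤ m → ∀ s a,
      weakDerivNorm Ω p q α (testClass (Φ s a)) ≤ C * seqNorm q s a) := by
    intro α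
    obtain ⟨M, hM, hgM⟩ := exists_forall_abs_le (reverseDeriv α φ)
    obtain ⟨C, hC, h⟩ := hB.exists_lorentzNorm_sum_le hd (hvanish α) hp hq hM hgM
    refine ⟨C, hC, fun hα s a => ?_⟩
    rw [weakDerivNorm_testClass, hder]
    exact h s a _ (hck _ hα)
  choose K hK hKU using hU
  set C₁ : ℝ≥0∞ := ∑ k ∈ Finset.range (m + 1),
    ∑ α ∈ Finset.piAntidiag (Finset.univ : Finset (Fin d)) k, K α
  have hC₁ : C₁ ≠ ∞ := ENNReal.sum_ne_top.2 fun k _ => ENNReal.sum_ne_top.2 fun α _ => hK α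
  have h₁ : ∀ s a, sobolevNorm Ω m p q (testClass (Φ s a)) ≤ C₁ * seqNorm q s a := by
    intro s a
    unfold sobolevNorm
    simp only [C₁, Finset.sum_mul]
    refine Finset.sum_le_sum fun k hk => Finset.sum_le_sum fun α hα => hKU α ?_ s a
    have : ∑ i, α i = k := by simpa using hα
    rw [this]
    exact Finset.mem_range_succ_iff.1 hk
  -- the lower bound for a derivative of order `m`
  let α₀ : Fin d → ℕ := Pi.single ⟨0, hd⟩ m
  have hα₀ : ∑ i, α₀ i = m := by simp [α₀]
  obtain ⟨C₂, hC₂, h₂⟩ := hB.exists_seqNorm_le_lorentzNorm_sum hd (hvanish α₀) hp hq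
    (reverseDeriv α₀ φ).continuous fun h => hφ0
      ((injective_iff_map_eq_zero _).1 (listDeriv_injective α₀ _) φ (DFunLike.coe_injective h))
  have h₂' : ∀ s a, seqNorm q s a ≤ C₂ * sobolevNorm Ω m p q (testClass (Φ s a)) := by
    intro s a
    refine (h₂ s a (fun j => c j * L j ^ m) hcm).trans ?_
    gcongr
    refine le_trans (le_of_eq ?_) (weakDerivNorm_le_sobolevNorm Ω p q hα₀ _)
    rw [weakDerivNorm_testClass, hder, hα₀]
  -- the target norm
  have hφv : ∀ x, x ∉ Metric.closedBall (0 : EuclideanSpace ℝ (Fin d)) 1 → φ x = 0 :=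
    fun x hx => image_eq_zero_of_notMem_tsupport fun h => hx (hφ h)
  have hval : ∀ s a, (Φ s a : EuclideanSpace ℝ (Fin d) → ℝ) = fun x =>
      ∑ j ∈ s, a j * c j * φ (L j • (x - y j)) := by
    intro s a
    funext x
    simp only [Φ]
    rw [FunLike.coe_sum, Finset.sum_apply]
    exact Finset.sum_congr rfl fun j _ => (mul_assoc _ _ _).symm
  have hcabs : ∀ j, |c j| ≤ (L j ^ d)⁻¹ ^ (-1 / σ) := fun j =>
    (abs_of_pos (Real.rpow_pos_of_pos ((hB.halving hd).pos j) _)).le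
  obtain ⟨M, hM, hgM⟩ := exists_forall_abs_le φ
  obtain ⟨C₃, hC₃, h₃⟩ := hB.exists_lorentzNorm_sum_le hd hφv hconj hr hM hgM
  obtain ⟨C₄, hC₄, h₄⟩ := hB.exists_seqNorm_le_lorentzNorm_sum hd hφv hconj hr
    φ.continuous fun h => hφ0 (DFunLike.coe_injective h)
  have h₃' : ∀ s a, lorentzNormOn Ω σ r (testClass (Φ s a)) ≤ C₃ * seqNorm r s a := by
    intro s a
    rw [lorentzNormOn_testClass, hval]
    exact h₃ s a c hcabs
  have h₄' : ∀ s a, seqNorm r s a ≤ C₄ * lorentzNormOn Ω σ r (testClass (Φ s a)) := by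
    intro s a
    rw [lorentzNormOn_testClass, hval]
    exact h₄ s a c fun _ => rfl
  set v : ℕ → MeasFun Ω := fun j => testClass (scaledBump hB hφ (c j) j)
  have hv : ∀ l : ℕ →₀ ℝ, Finsupp.linearCombination ℝ v l = testClass (Φ l.support l) := by
    intro l
    rw [Finsupp.linearCombination_apply]
    exact ((map_sum testClassLinear _ _).trans
      (Finset.sum_congr rfl fun j _ => map_smul testClassLinear _ _)).symm
  -- If a combination vanishes, so does its Sobolev norm, and the lower `ℓ^q` estimate kills every
  -- coefficient.
  have hli : LinearIndependent ℝ v := by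
    refine (injective_iff_map_eq_zero (Finsupp.linearCombination ℝ v)).2 fun l hl => ?_
    have h0 : testClass (Φ l.support l) = testClass (0 : 𝓓(Ω, ℝ)) := by
      rw [← hv, hl]
      exact (map_zero testClassLinear).symm
    have h := h₂' l.support l
    rw [h0, sobolevNorm_testClass_zero hp hq, mul_zero, nonpos_iff_eq_zero] at h
    ext j
    by_contra hj
    exact hj (eq_zero_of_seqNorm_eq_zero hq h (Finsupp.mem_support_iff.2 hj))
  set C : ℝ≥0∞ := C₁ + C₂ + C₃ + C₄ + 1
  have hC : C ≠ ∞ := by finiteness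
  have hCC : ((C.toNNReal : ℝ≥0) : ℝ≥0∞) = C := ENNReal.coe_toNNReal hC
  have hle₁ : C₁ ≤ C := by simp only [C, add_assoc]; exact le_self_add
  have hle₂ : C₂ ≤ C := by
    simp only [C, add_assoc]; exact le_add_left le_self_add
  have hle₃ : C₃ ≤ C := by
    simp only [C, add_assoc]; exact le_add_left (le_add_left le_self_add)
  have hle₄ : C₄ ≤ C := by
    simp only [C, add_assoc]; exact le_add_left (le_add_left (le_add_left le_self_add))
  refine ⟨v, C.toNNReal, ENNReal.toNNReal_pos (by simp [C]) hC, hli, fun l => ?_⟩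
  rw [hv, hCC]
  refine ⟨testClass_mem_sobolevSpaceZero hp hq ?_, (h₁ _ _).trans (by gcongr),
    (h₂' _ _).trans (by gcongr), (h₃' _ _).trans (by gcongr), (h₄' _ _).trans (by gcongr)⟩
  exact (h₁ _ _).trans_lt (ENNReal.mul_lt_top hC₁.lt_top (seqNorm_ne_top _ _ _).lt_top)

/-! ### Bernstein numbers, strict singularity and sharpness -/

theorem exists_le_sobolevBernstein {d m : ℕ} {p : ℝ} (hd : 0 < d) (hp : 0 < p)
    (hmp : m * p < d) {q r : ℝ≥0∞} (hq : 0 < q) (hqr : q ≤ r)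
    (Ω : Opens (EuclideanSpace ℝ (Fin d))) (hΩ : (Ω : Set (EuclideanSpace ℝ (Fin d))).Nonempty) :
    ∃ c : ℝ, 0 < c ∧ ∀ n : ℕ, 1 ≤ n →
      ENNReal.ofReal (c * (n : ℝ) ^ ((1 / r).toReal - (1 / q).toReal)) ≤
        sobolevBernstein Ω m p q r n := by
  obtain ⟨v, C, hC, hli, hv⟩ := exists_bump_sequence hd hp hmp hq (hq.trans_le hqr) Ω hΩ
  refine ⟨((C : ℝ) * C)⁻¹, by positivity, fun n hn => ?_⟩
  have hn0 : (0 : ℝ) < n := by exact_mod_cast hn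
  set e := (1 / r).toReal - (1 / q).toReal
  have he : 0 ≤ (1 / q).toReal - (1 / r).toReal :=
    sub_nonneg.2 (ENNReal.toReal_mono (by simp [hq.ne']) (ENNReal.div_le_div_left hqr 1))
  have hli' : LinearIndependent ℝ fun i : Fin n => v i := hli.comp _ Fin.val_injective
  have hmem : ∀ x ∈ Submodule.span ℝ (Set.range fun i : Fin n => v i), ∃ l : ℕ →₀ ℝ,
      l.support.card ≤ n ∧ Finsupp.linearCombination ℝ v l = x := by
    intro x hx
    have : (Set.range fun i : Fin n => v i) = v '' (Finset.range n : Set ℕ) := by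
      ext w
      simp [Fin.exists_iff]
    rw [this, Finsupp.mem_span_image_iff_linearCombination] at hx
    obtain ⟨l, hl, hlx⟩ := hx
    refine ⟨l, ?_, hlx⟩
    have hl' : l.support ⊆ Finset.range n := by
      exact_mod_cast (Finsupp.mem_supported ℝ l).1 hl
    simpa using Finset.card_le_card hl'
  refine le_trans ?_ (le_iSup₂_of_le (Submodule.span ℝ (Set.range fun i : Fin n => v i)) ?_
    (le_iSup₂_of_le (FiniteDimensional.span_of_finite ℝ (Set.finite_range _))
      ((finrank_span_eq_card hli').trans (Fintype.card_fin n)) le_rfl))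
  · refine le_iInf₂ fun x hx => le_iInf fun hx1 => ?_
    obtain ⟨l, hl, rfl⟩ := hmem x hx
    obtain ⟨-, h1, -, -, h4⟩ := hv l
    set N := lorentzNormOn Ω (sobolevConj d m p) r (Finsupp.linearCombination ℝ v l)
    have hcard : (l.support.card : ℝ≥0∞) ^ ((1 / q).toReal - (1 / r).toReal) ≤
        ENNReal.ofReal ((n : ℝ) ^ (-e)) := by
      rw [← ENNReal.ofReal_rpow_of_pos hn0, ENNReal.ofReal_natCast,
        show -e = (1 / q).toReal - (1 / r).toReal by simp [e]]
      gcongr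
    -- One factor `C` comes from each norm comparison and the power of `n` from Hölder's inequality,
    -- since at most `n` coefficients are non-zero. Hence the constant `(C * C)⁻¹`.
    have key : 1 ≤ ENNReal.ofReal ((n : ℝ) ^ (-e) * (C * C)) * N := by
      calc 1 ≤ C * seqNorm q l.support l := hx1 ▸ h1
        _ ≤ C * (ENNReal.ofReal ((n : ℝ) ^ (-e)) * (C * N)) := by
            gcongr
            refine (seqNorm_le_card_rpow_mul_seqNorm hq hqr _ _).trans ?_
            gcongr
        _ = _ := by
            rw [ENNReal.ofReal_mul (by positivity), ENNReal.ofReal_mul (by positivity),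
              ENNReal.ofReal_coe_nnreal]
            ring
    calc ENNReal.ofReal (((C : ℝ) * C)⁻¹ * (n : ℝ) ^ e)
        ≤ ENNReal.ofReal (((C : ℝ) * C)⁻¹ * (n : ℝ) ^ e) *
            (ENNReal.ofReal ((n : ℝ) ^ (-e) * (C * C)) * N) := le_mul_of_one_le_right' key
      _ = N := by
          rw [← mul_assoc, ← ENNReal.ofReal_mul (by positivity), Real.rpow_neg hn0.le]
          have h1 : (n : ℝ) ^ e ≠ 0 := (Real.rpow_pos_of_pos hn0 e).ne'
          have h2 : (C : ℝ) ≠ 0 := by exact_mod_cast hC.ne'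
          rw [show ((C : ℝ) * C)⁻¹ * (n : ℝ) ^ e * (((n : ℝ) ^ e)⁻¹ * (C * C)) = 1 by field_simp]
          simp
      _ ≤ _ := le_rfl
  · intro x hx
    obtain ⟨l, -, rfl⟩ := hmem x hx
    exact (hv l).1

/-- For equal second indices both norms are equivalent to the same `ℓ^q` norm of the coefficients on
the infinite-dimensional span of all the bumps. -/
theorem not_strictlySingular_sobolev {d m : ℕ} {p : ℝ} (hd : 0 < d) (hp : 0 < p)
    (hmp : m * p < d) {q : ℝ≥0∞} (hq : 0 < q)
    (Ω : Opens (EuclideanSpace ℝ (Fin d))) (hΩ : (Ω : Set (EuclideanSpace ℝ (Fin d))).Nonempty) :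
    ¬ StrictlySingular (sobolevSpaceZero Ω m p q) (sobolevNorm Ω m p q)
      (lorentzNormOn Ω (sobolevConj d m p) q) LinearMap.id := by
  obtain ⟨v, C, hC, hli, hv⟩ := exists_bump_sequence hd hp hmp hq hq Ω hΩ
  refine not_not_intro ⟨Submodule.span ℝ (Set.range v), fun x hx => ?_, fun hfin => ?_,
    (C * C)⁻¹, C * C, by positivity, fun x hx => ?_⟩
  · obtain ⟨l, rfl⟩ := (Finsupp.mem_span_range_iff_exists_finsupp).1 hx
    exact (hv l).1
  · have := (linearIndependent_span hli).finite
    exact not_finite ℕ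
  · obtain ⟨l, rfl⟩ := (Finsupp.mem_span_range_iff_exists_finsupp).1 hx
    obtain ⟨-, h1, h2, h3, h4⟩ := hv l
    have hCC : C * C ≠ 0 := by positivity
    rw [Finsupp.linearCombination_apply] at h1 h2 h3 h4
    rw [LinearMap.id_apply, ENNReal.coe_inv hCC, ENNReal.inv_mul_le_iff (by simpa using hC.ne')
      ENNReal.coe_ne_top, ENNReal.coe_mul, mul_assoc, mul_assoc]
    exact ⟨h1.trans (by gcongr), h3.trans (by gcongr)⟩

/-- If `c n^e ≤ C n^{-β}` for all `n ≥ 1`, with `c > 0`, then `β ≤ -e`. -/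
lemma le_neg_of_forall_mul_rpow_le {c C e β : ℝ} (hc : 0 < c)
    (h : ∀ n : ℕ, 1 ≤ n → c * (n : ℝ) ^ e ≤ C * (n : ℝ) ^ (-β)) : β ≤ -e := by
  by_contra! hlt
  have hpos : 0 < e + β := by linarith
  -- Were `e + β` positive, `n ^ (e + β)` would eventually exceed `C / c`.
  have ht := (tendsto_rpow_atTop hpos).comp tendsto_natCast_atTop_atTop
  obtain ⟨n, hn, hn1⟩ := ((ht.eventually_gt_atTop (C / c)).and
    (Filter.eventually_ge_atTop 1)).exists
  have hn0 : (0 : ℝ) < n := by exact_mod_cast hn1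
  have h1 := h n hn1
  have h2 : C < (n : ℝ) ^ (e + β) * c := (div_lt_iff₀ hc).1 hn
  rw [Real.rpow_add hn0] at h2
  rw [Real.rpow_neg hn0.le, ← div_eq_mul_inv, le_div_iff₀ (Real.rpow_pos_of_pos hn0 β)] at h1
  linarith

lemma upperExponent_eq {d m : ℕ} {p q r ε : ℝ} (hp : 0 < p) (hq : 0 < q) (hε : p + ε ≤ q)
    (hε0 : 0 < ε) (hε' : p / sobolevConj d m p + ε ≤ q / r) :
    upperExponent d m p q r ε = 1 / q - 1 / r := by
  unfold upperExponent
  rw [min_eq_right (one_div_le_one_div_of_le (by linarith) hε), max_eq_left hε']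
  field_simp

end

theorem mainTheorem4 (d m : ℕ) (hm : 1 ≤ m) (p : ℝ) (hp : 1 ≤ p) (hpd : p < (d : ℝ) / m)
    (q r : ℝ≥0∞) (hq : 0 < q) (hqr : q ≤ r) (hp1 : p = 1 → q ≤ 1)
    (Ω : Opens (EuclideanSpace ℝ (Fin d))) (hΩ : (Ω : Set (EuclideanSpace ℝ (Fin d))).Nonempty) :
    -- the lower bound
    (∃ c : ℝ, 0 < c ∧ ∀ n : ℕ, 1 ≤ n →
      ENNReal.ofReal (c * (n : ℝ) ^ ((1 / r).toReal - (1 / q).toReal)) ≤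
        sobolevBernstein Ω m p q r n) ∧
    -- for `p < q < r < p*` and small `ε` the exponent of the upper bound cannot be improved
    (ENNReal.ofReal p < q → q < r → r < ENNReal.ofReal (sobolevConj d m p) →
      ∃ ε₀ : ℝ, 0 < ε₀ ∧ ∀ ε : ℝ, 0 < ε → ε < ε₀ →
        upperExponent d m p q.toReal r.toReal ε = 1 / q.toReal - 1 / r.toReal ∧
        ∀ β C : ℝ,
          (∀ n : ℕ, 1 ≤ n →
            sobolevBernstein Ω m p q r n ≤ ENNReal.ofReal (C * (n : ℝ) ^ (-β))) →
          β ≤ upperExponent d m p q.toReal r.toReal ε) ∧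
    -- for `q = r` the embedding is not strictly singular
    (q = r →
      ¬ StrictlySingular (sobolevSpaceZero Ω m p q) (sobolevNorm Ω m p q)
        (lorentzNormOn Ω (sobolevConj d m p) r) LinearMap.id) := by
  have hp0 : 0 < p := by linarith
  have hm0 : (0 : ℝ) < m := by exact_mod_cast hm
  have hmp : m * p < d := by
    rw [mul_comm]
    exact (lt_div_iff₀ hm0).1 hpd
  have hd : 0 < d := by
    have : (0 : ℝ) < d := lt_trans (by positivity) hmp
    exact_mod_cast this
  obtain ⟨c, hc, hlow⟩ := exists_le_sobolevBernstein hd hp0 hmp hq hqr Ω hΩ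
  refine ⟨⟨c, hc, hlow⟩, fun hpq hqr' hrp => ?_, fun h => ?_⟩
  · have hr' : r ≠ ∞ := hrp.ne_top
    have hq' : q ≠ ∞ := hqr'.ne_top
    have hq0 : 0 < q.toReal := ENNReal.toReal_pos hq.ne' hq'
    have hpq0 : p < q.toReal := (ENNReal.ofReal_lt_iff_lt_toReal hp0.le hq').1 hpq
    have hqr0 : q.toReal < r.toReal := (ENNReal.toReal_lt_toReal hq' hr').2 hqr'
    have hconj := sobolevConj_pos hd hp0 hmp
    have hrp0 : r.toReal < sobolevConj d m p := (ENNReal.lt_ofReal_iff_toReal_lt hr').1 hrp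
    have hr0 : 0 < r.toReal := hq0.trans hqr0
    -- The strict inequalities `p < q` and `r < p*` leave room for `ε`: below `ε₀` the minimum in
    -- the exponent is `1 / q` and the maximum is `q / r`.
    have hlt : p / sobolevConj d m p < q.toReal / r.toReal := by
      calc p / sobolevConj d m p < q.toReal / sobolevConj d m p := by gcongr
        _ < q.toReal / r.toReal := by gcongr
    refine ⟨min (q.toReal - p) (q.toReal / r.toReal - p / sobolevConj d m p),
      lt_min (by linarith) (by linarith), fun ε hε hε' => ?_⟩
    have heq : upperExponent d m p q.toReal r.toReal ε = 1 / q.toReal - 1 / r.toReal :=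
      upperExponent_eq hp0 hq0 (by linarith [hε'.trans_le (min_le_left _ _)]) hε
        (by linarith [hε'.trans_le (min_le_right _ _)])
    refine ⟨heq, fun β C hup => ?_⟩
    rw [heq]
    have h := le_neg_of_forall_mul_rpow_le (β := β) (C := C) hc fun n hn => by
      have hn0 : (0 : ℝ) < n := by exact_mod_cast hn
      -- The comparison descends to the reals for any sign of `C`, because the lower bound is
      -- strictly positive.
      exact (ENNReal.ofReal_le_ofReal_iff'.1 ((hlow n hn).trans (hup n hn))).resolve_right
        (not_le.2 (by positivity))
    simpa using h
  · subst h
    exact not_strictlySingular_sobolev hd hp0 hmp hq Ω hΩ
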